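/- Let $M$ be a connected smooth ($C^\infty$, finite-dimensional, Hausdorff, second countable, boundaryless) manifold and let $\mathcal E^1(M)=(TM\times\mathbb R)\oplus(T^*M\times\mathbb R)$, with the pairing $$\langle (X_1,f_1)+(\alpha_1,g_1),(X_2,f_2)+(\alpha_2,g_2)\rangle_+=\tfrac12\big(i_{X_2}\alpha_1+f_2g_1+i_{X_1}\alpha_2+f_1g_2\big)$$ and, on sections, the bracket $$\begin{aligned}{}[(X_1,f_1)+(\alpha_1,g_1),(X_2,f_2)+(\alpha_2,g_2)]={}&\big([X_1,X_2],\,X_1(f_2)-X_2(f_1)\big)\\&+\Big(\mathcal L_{X_1}\alpha_2-\mathcal L_{X_2}\alpha_1+\tfrac12 d(i_{X_2}\alpha_1-i_{X_1}\alpha_2)+f_1\alpha_2-f_2\alpha_1\\&\quad+\tfrac12(g_2df_1-g_1df_2-f_1dg_2+f_2dg_1),\\&\quad X_1(g_2)-X_2(g_1)+\tfrac12(i_{X_2}\alpha_1-i_{X_1}\alpha_2-f_2g_1+f_1g_2)\Big).\end{aligned}$$ Let $L$ be an $\mathcal E^1(M)$-Dirac structure, i.e. a smooth vector sub-bundle of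 $\mathcal E^1(M)$ whose fibres are maximally isotropic for $\langle\,,\rangle_+$ and such that $\Gamma(L)$ is closed under $[\,,]$. Put $\rho_L((X,f)+(\alpha,g))=X$ and $\phi_L((X,f)+(\alpha,g))=f$ on $L$, and let $[\,,]_L$ be the restriction of $[\,,]$ to $\Gamma(L)$. On the vector bundle $\bar L=L\times\mathbb R\to M\times\mathbb R$, whose sections are the time-dependent sections of $L$, consider $$[\bar e_1,\bar e_2]_L^{\bar{}\,\phi_L}(x,t)=[(\bar e_1)_t,(\bar e_2)_t]_L(x)+\Big(\phi_L(\bar e_1)\frac{\partial\bar e_2}{\partial t}-\phi_L(\bar e_2)\frac{\partial\bar e_1}{\partial t}\Big)(x,t),\qquad \bar\rho_L^{\phi_L}(\bar e)=\rho_L(\bar e)+\phi_L(\bar e)\frac{\partial}{\partial t}.$$ For $(x,t)\in M\times\mathbb R$ let $$\psi_{(x,t)}\big((u,\lambda)+(\alpha,\mu)\big)=\Big(u+\lambda\frac{\partial}{\partial t}\Big)+e^t(\alpha+\mu\,dt),\qquad \tilde L_{(x,t)}=\psi_{(x,t)}(L_x)\subseteq T_{(x,t)}(M\times\mathbb R)\oplus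 T^*_{(x,t)}(M\times\mathbb R).$$ Then $\tilde L$ is a Dirac structure on $M\times\mathbb R$, that is, a smooth vector sub-bundle of $T(M\times\mathbb R)\oplus T^*(M\times\mathbb R)$ with fibres maximally isotropic for $\langle X_1+\alpha_1,X_2+\alpha_2\rangle_+=\tfrac12(i_{X_2}\alpha_1+i_{X_1}\alpha_2)$ and with $\Gamma(\tilde L)$ closed under the Courant bracket $$[X_1+\alpha_1,X_2+\alpha_2]^{\tilde{}}=[X_1,X_2]+\mathcal L_{X_1}\alpha_2-\mathcal L_{X_2}\alpha_1+\tfrac12d(i_{X_2}\alpha_1-i_{X_1}\alpha_2).$$ Moreover $(\bar L,[\,,]_L^{\bar{}\,\phi_L},\bar\rho_L^{\phi_L})$ and $(\tilde L,[\,,]^{\tilde{}}_{\tilde L},\tilde\rho_{\tilde L})$, where $\tilde\rho_{\tilde L}(X+\alpha)=X$ on $\tilde L$, are Lie algebroids over $M\times\mathbb R$, and the maps $\psi_{(x,t)}$ define an isomorphism of Lie algebroids $\tilde\psi:\bar L\to\tilde L$ over the identity: $\tilde\psi$ is an isomorphism of smooth vector bundles over the identity and $$\tilde\rho_{\tilde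 L}(\tilde\psi(\bar e_1))=\bar\rho_L^{\phi_L}(\bar e_1),\qquad \tilde\psi[\bar e_1,\bar e_2]_L^{\bar{}\,\phi_L}=[\tilde\psi(\bar e_1),\tilde\psi(\bar e_2)]^{\tilde{}}_{\tilde L}\qquad(\bar e_1,\bar e_2\in\Gamma(\bar L)).$$ Consequently the characteristic foliation $\mathcal F_{\tilde L}$ of $\tilde L$ coincides with the Lie algebroid foliation $\mathcal F_{\bar L}$ of $\bar L$: $\tilde\rho_{\tilde L}(\tilde L_{(x,t)})=\bar\rho_L^{\phi_L}(\bar L_{(x,t)})$ for all $(x,t)\in M\times\mathbb R$, and the two foliations have the same leaf through every point of $M\times\mathbb R$. Here the leaf through $p$ is the set of points that can be joined to $p$ by a continuous piecewise smooth path tangent to the foliation along which the dimension of the characteristic space is constant. -/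

import Mathlib

open Set Bundle Topology
open scoped Manifold ContDiff Bundle

noncomputable section

/-! ### Sub-bundles, Lie algebroids and their foliations

A real smooth vector bundle over a manifold `B` is presented as a sub-bundle `A` of an ambient
smooth vector bundle `V` (a vector bundle is a sub-bundle of itself).  Fibrewise maps out of `A`
are given as restrictions to `A` of fibrewise linear maps on `V`, and brackets on `Γ(A)` as
restrictions of operations on arbitrary sections of `V`. -/

section General

variable {EB : Type*} [NormedAddCommGroup EB] [NormedSpace ℝ EB]
  {HB : Type*} [TopologicalSpace HB] (I : ModelWithCorners ℝ EB HB)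
  {B : Type*} [TopologicalSpace B] [ChartedSpace HB B]

section VectorBundles

variable (F : Type*) [NormedAddCommGroup F] [NormedSpace ℝ F]
  {V : B → Type*} [TopologicalSpace (TotalSpace F V)]
  [∀ x, AddCommMonoid (V x)] [∀ x, Module ℝ (V x)] [∀ x, TopologicalSpace (V x)]
  [FiberBundle F V]

/-- `A` is a smooth vector sub-bundle of `V`: it has smooth local frames. -/
def IsSubbundle (A : ∀ x, Submodule ℝ (V x)) : Prop :=
  ∀ x₀ : B, ∃ U : Set B, IsOpen U ∧ x₀ ∈ U ∧ ∃ (k : ℕ) (s : Fin k → ∀ x, V x),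
    (∀ i, ContMDiffOn I (I.prod 𝓘(ℝ, F)) ∞ (fun x ↦ TotalSpace.mk' F x (s i x)) U) ∧
    ∀ x ∈ U, LinearIndependent ℝ (fun i ↦ s i x) ∧
      Submodule.span ℝ (range fun i ↦ s i x) = A x

/-- `s ∈ Γ(A)`: `s` is a global smooth section of `V` with values in `A`. -/
structure IsSection (A : ∀ x, Submodule ℝ (V x)) (s : ∀ x, V x) : Prop where
  smooth : ContMDiff I (I.prod 𝓘(ℝ, F)) ∞ (fun x ↦ TotalSpace.mk' F x (s x))
  mem : ∀ x, s x ∈ A x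

/-- `(A, br, ρ)` is a Lie algebroid: `A` is a vector bundle, `br` is a Lie bracket on `Γ(A)`, and
`ρ : A → TB` is a bundle map inducing a Lie algebra homomorphism `Γ(A) → 𝔛(B)` and satisfying
the Leibniz rule. -/
structure IsLieAlgebroid [IsManifold I ∞ B] (A : ∀ x, Submodule ℝ (V x))
    (br : (∀ x, V x) → (∀ x, V x) → ∀ x, V x)
    (ρ : ∀ x, V x →ₗ[ℝ] TangentSpace I x) : Prop where
  subbundle : IsSubbundle I F A
  bracket_mem : ∀ s t, IsSection I F A s → IsSection I F A t → IsSection I F A (br s t)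
  add_left : ∀ s s' t, IsSection I F A s → IsSection I F A s' → IsSection I F A t →
    br (s + s') t = br s t + br s' t
  smul_left : ∀ (c : ℝ) s t, IsSection I F A s → IsSection I F A t →
    br (c • s) t = c • br s t
  skew : ∀ s t, IsSection I F A s → IsSection I F A t → br s t + br t s = 0
  jacobi : ∀ s t u, IsSection I F A s → IsSection I F A t → IsSection I F A u →
    br (br s t) u + br (br t u) s + br (br u s) t = 0
  anchor_smooth : ∀ s, IsSection I F A s →
    ContMDiff I (I.prod 𝓘(ℝ, EB)) ∞
      (fun x ↦ (TotalSpace.mk' EB x (ρ x (s x)) : TangentBundle I B))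
  anchor_bracket : ∀ s t, IsSection I F A s → IsSection I F A t →
    ∀ x, ρ x (br s t x) =
      VectorField.mlieBracket I (fun y ↦ ρ y (s y)) (fun y ↦ ρ y (t y)) x
  leibniz : ∀ (f : B → ℝ) s t, ContMDiff I 𝓘(ℝ, ℝ) ∞ f →
    IsSection I F A s → IsSection I F A t →
    ∀ x, br s (fun y ↦ f y • t y) x = f x • br s t x + mvfderiv I f x (ρ x (s x)) • t x

end VectorBundles

section Isomorphisms

variable [IsManifold I ∞ B] (F₁ : Type*) [NormedAddCommGroup F₁] [NormedSpace ℝ F₁]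
  {V₁ : B → Type*} [TopologicalSpace (TotalSpace F₁ V₁)]
  [∀ x, AddCommMonoid (V₁ x)] [∀ x, Module ℝ (V₁ x)] [∀ x, TopologicalSpace (V₁ x)]
  [FiberBundle F₁ V₁]
  (F₂ : Type*) [NormedAddCommGroup F₂] [NormedSpace ℝ F₂]
  {V₂ : B → Type*} [TopologicalSpace (TotalSpace F₂ V₂)]
  [∀ x, AddCommMonoid (V₂ x)] [∀ x, Module ℝ (V₂ x)] [∀ x, TopologicalSpace (V₂ x)]
  [FiberBundle F₂ V₂]

/-- `Ψ` restricts to an isomorphism `A₁ → A₂` of smooth vector bundles over the identity: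
it is a fibrewise linear bijection, and a (local) section of `A₁` is smooth exactly when its image
is. -/
structure IsBundleIso (A₁ : ∀ x, Submodule ℝ (V₁ x)) (A₂ : ∀ x, Submodule ℝ (V₂ x))
    (Ψ : ∀ x, V₁ x →ₗ[ℝ] V₂ x) : Prop where
  bijOn : ∀ x, BijOn (Ψ x) (A₁ x) (A₂ x)
  smooth_iff : ∀ s : ∀ x, V₁ x, (∀ x, s x ∈ A₁ x) → ∀ x₀,
    (ContMDiffAt I (I.prod 𝓘(ℝ, F₁)) ∞ (fun x ↦ TotalSpace.mk' F₁ x (s x)) x₀ ↔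
      ContMDiffAt I (I.prod 𝓘(ℝ, F₂)) ∞ (fun x ↦ TotalSpace.mk' F₂ x (Ψ x (s x))) x₀)

/-- `Ψ` restricts to an isomorphism over the identity from the Lie algebroid `(A₁, br₁, ρ₁)` to
the Lie algebroid `(A₂, br₂, ρ₂)`. -/
structure IsLieAlgebroidIso
    (A₁ : ∀ x, Submodule ℝ (V₁ x)) (br₁ : (∀ x, V₁ x) → (∀ x, V₁ x) → ∀ x, V₁ x)
    (ρ₁ : ∀ x, V₁ x →ₗ[ℝ] TangentSpace I x)
    (A₂ : ∀ x, Submodule ℝ (V₂ x)) (br₂ : (∀ x, V₂ x) → (∀ x, V₂ x) → ∀ x, V₂ x)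
    (ρ₂ : ∀ x, V₂ x →ₗ[ℝ] TangentSpace I x)
    (Ψ : ∀ x, V₁ x →ₗ[ℝ] V₂ x) : Prop where
  source : IsLieAlgebroid I F₁ A₁ br₁ ρ₁
  target : IsLieAlgebroid I F₂ A₂ br₂ ρ₂
  bundleIso : IsBundleIso I F₁ F₂ A₁ A₂ Ψ
  anchor : ∀ x, ∀ a ∈ A₁ x, ρ₂ x (Ψ x a) = ρ₁ x a
  bracket : ∀ s t, IsSection I F₁ A₁ s → IsSection I F₁ A₁ t →
    ∀ x, Ψ x (br₁ s t x) = br₂ (fun y ↦ Ψ y (s y)) (fun y ↦ Ψ y (t y)) x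

end Isomorphisms

/-- The characteristic space `ρ(A_x)` at `x` of the foliation of a Lie algebroid with anchor `ρ`. -/
def algebroidFoliation {V : B → Type*} [∀ x, AddCommMonoid (V x)] [∀ x, Module ℝ (V x)]
    (A : ∀ x, Submodule ℝ (V x)) (ρ : ∀ x, V x →ₗ[ℝ] TangentSpace I x) (x : B) :
    Submodule ℝ (TangentSpace I x) :=
  (A x).map (ρ x)

/-- A smooth arc from `x` to `y` tangent to `D`, along which the rank of `D` is constant. -/
def TangentArc (D : ∀ x : B, Submodule ℝ (TangentSpace I x)) (x y : B) : Prop :=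
  ∃ γ : ℝ → B, ContMDiffOn 𝓘(ℝ, ℝ) I ∞ γ (Icc 0 1) ∧ γ 0 = x ∧ γ 1 = y ∧
    ∀ t ∈ Icc (0 : ℝ) 1,
      mfderivWithin 𝓘(ℝ, ℝ) I γ (Icc 0 1) t (1 : ℝ) ∈ D (γ t) ∧
      Module.finrank ℝ (D (γ t)) = Module.finrank ℝ (D x)

/-- The leaf through `x` of the generalized foliation `D`: the points reached from `x` along
continuous piecewise smooth paths tangent to `D` on which the rank of `D` is constant. -/
def leaf (D : ∀ x : B, Submodule ℝ (TangentSpace I x)) (x : B) : Set B :=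
  {y | Relation.ReflTransGen (TangentArc I D) x y}

end General

/-! ### Dirac structures and `ℰ¹(M)`-Dirac structures -/

section Dirac

variable {E : Type*} [NormedAddCommGroup E] [NormedSpace ℝ E]
  {H : Type*} [TopologicalSpace H] (I : ModelWithCorners ℝ E H)
  {M : Type*} [TopologicalSpace M] [ChartedSpace H M]

/-- The cotangent space `T*ₓM`. -/
abbrev CotangentSpace (x : M) : Type _ := TangentSpace I x →L[ℝ] ℝ

/-- The vector field `X` read in the preferred chart at `x`. -/
def chartField (x : M) (X : ∀ y : M, TangentSpace I y) : E → E :=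
  fun z ↦ VectorField.mpullbackWithin 𝓘(ℝ, E) I (extChartAt I x).symm X (range I) z

/-- The one-form `α` read in the preferred chart at `x`. -/
def chartForm (x : M) (α : ∀ y : M, CotangentSpace I y) : E → (E →L[ℝ] ℝ) :=
  fun z ↦ (α ((extChartAt I x).symm z)).comp
    (mfderivWithin 𝓘(ℝ, E) I (extChartAt I x).symm (range I) z)

/-- The Lie derivative `ℒ_X α` of a one-form, computed at `x` in the preferred chart at `x`,
where `(ℒ_X α)(v) = (Dα · X)(v) + α(DX · v)`. -/
def lieDerivForm (X : ∀ y : M, TangentSpace I y) (α : ∀ y : M, CotangentSpace I y) (x : M) :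
    CotangentSpace I x :=
  let z : E := extChartAt I x x
  let β : E →L[ℝ] ℝ :=
    fderivWithin ℝ (chartForm I x α) (range I) z (chartField I x X z)
      + (chartForm I x α z).comp (fderivWithin ℝ (chartField I x X) (range I) z)
  β.comp (mfderiv I 𝓘(ℝ, E) (extChartAt I x) x)

/-- `S` is maximally isotropic for the pairing `b`. -/
def IsMaxIsotropic {W : Type*} [AddCommGroup W] [Module ℝ W] (b : W → W → ℝ)
    (S : Submodule ℝ W) : Prop :=
  Maximal (fun T : Submodule ℝ W ↦ ∀ a ∈ T, ∀ c ∈ T, b a c = 0) S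

variable (M) in
/-- The bundle `TM ⊕ T*M`; an element `u + α` is written `(u, α)`. -/
abbrev Pontryagin : M → Type _ := (TangentSpace I : M → Type _) ×ᵇ (CotangentSpace I)

/-- The model fibre of `TM ⊕ T*M`. -/
abbrev PontryaginModel (E : Type*) [NormedAddCommGroup E] [NormedSpace ℝ E] : Type _ :=
  E × (E →L[ℝ] ℝ)

/-- The pairing `⟨ , ⟩₊` on `TM ⊕ T*M`. -/
def pontryaginPairing (x : M) (a b : Pontryagin I M x) : ℝ :=
  (1 / 2 : ℝ) * (a.2 b.1 + b.2 a.1)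

/-- The projection `u + α ↦ u`. -/
def pontryaginAnchor (x : M) : Pontryagin I M x →ₗ[ℝ] TangentSpace I x :=
  LinearMap.fst ℝ _ _

/-- The Courant bracket on sections of `TM ⊕ T*M`. -/
def courantBracket (a b : ∀ x, Pontryagin I M x) (x : M) : Pontryagin I M x :=
  let X₁ : ∀ y : M, TangentSpace I y := fun y ↦ (a y).1
  let X₂ : ∀ y : M, TangentSpace I y := fun y ↦ (b y).1
  let α₁ : ∀ y : M, CotangentSpace I y := fun y ↦ (a y).2
  let α₂ : ∀ y : M, CotangentSpace I y := fun y ↦ (b y).2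
  (VectorField.mlieBracket I X₁ X₂ x,
    lieDerivForm I X₁ α₂ x - lieDerivForm I X₂ α₁ x
      + (1 / 2 : ℝ) • mvfderiv I (fun y ↦ α₁ y (X₂ y) - α₂ y (X₁ y)) x)

/-- Dirac structures on `M` (in the sense of Courant-Weinstein). -/
structure IsDirac [IsManifold I ∞ M] (L : ∀ x, Submodule ℝ (Pontryagin I M x)) : Prop where
  subbundle : IsSubbundle I (PontryaginModel E) L
  maxIsotropic : ∀ x, IsMaxIsotropic (pontryaginPairing I x) (L x)
  closed : ∀ a b, IsSection I (PontryaginModel E) L a → IsSection I (PontryaginModel E) L b →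
    IsSection I (PontryaginModel E) L (courantBracket I a b)

variable (M) in
/-- The bundle `ℰ¹(M) = (TM × ℝ) ⊕ (T*M × ℝ)`; an element `(u, l) + (α, m)` is written
`((u, l), (α, m))`. -/
abbrev EOne : M → Type _ :=
  ((TangentSpace I : M → Type _) ×ᵇ (Trivial M ℝ)) ×ᵇ ((CotangentSpace I) ×ᵇ (Trivial M ℝ))

/-- The model fibre of `ℰ¹(M)`. -/
abbrev EOneModel (E : Type*) [NormedAddCommGroup E] [NormedSpace ℝ E] : Type _ :=
  (E × ℝ) × ((E →L[ℝ] ℝ) × ℝ)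

/-- The pairing `⟨ , ⟩₊` on `ℰ¹(M)`. -/
def eonePairing (x : M) (a b : EOne I M x) : ℝ :=
  (1 / 2 : ℝ) * (a.2.1 b.1.1 + b.1.2 * a.2.2 + b.2.1 a.1.1 + a.1.2 * b.2.2)

/-- The projection `ρ : (u, l) + (α, m) ↦ u`. -/
def eoneAnchor (x : M) : EOne I M x →ₗ[ℝ] TangentSpace I x :=
  LinearMap.fst ℝ (TangentSpace I x) ℝ ∘ₗ
    LinearMap.fst ℝ (TangentSpace I x × ℝ) (CotangentSpace I x × ℝ)

/-- The projection `(u, l) + (α, m) ↦ l`; its restriction to `L` is the one-cocycle `φ_L`. -/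
def eoneCocycle (x : M) : EOne I M x →ₗ[ℝ] ℝ :=
  LinearMap.snd ℝ (TangentSpace I x) ℝ ∘ₗ
    LinearMap.fst ℝ (TangentSpace I x × ℝ) (CotangentSpace I x × ℝ)

/-- The extended Courant bracket on sections of `ℰ¹(M)`. -/
def eoneBracket (a b : ∀ x, EOne I M x) (x : M) : EOne I M x :=
  let X₁ : ∀ y : M, TangentSpace I y := fun y ↦ (a y).1.1
  let X₂ : ∀ y : M, TangentSpace I y := fun y ↦ (b y).1.1
  let f₁ : M → ℝ := fun y ↦ (a y).1.2
  let f₂ : M → ℝ := fun y ↦ (b y).1.2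
  let α₁ : ∀ y : M, CotangentSpace I y := fun y ↦ (a y).2.1
  let α₂ : ∀ y : M, CotangentSpace I y := fun y ↦ (b y).2.1
  let g₁ : M → ℝ := fun y ↦ (a y).2.2
  let g₂ : M → ℝ := fun y ↦ (b y).2.2
  ((VectorField.mlieBracket I X₁ X₂ x,
    mvfderiv I f₂ x (X₁ x) - mvfderiv I f₁ x (X₂ x)),
   (lieDerivForm I X₁ α₂ x - lieDerivForm I X₂ α₁ x
      + (1 / 2 : ℝ) • mvfderiv I (fun y ↦ α₁ y (X₂ y) - α₂ y (X₁ y)) x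
      + f₁ x • α₂ x - f₂ x • α₁ x
      + (1 / 2 : ℝ) • (g₂ x • mvfderiv I f₁ x - g₁ x • mvfderiv I f₂ x
          - f₁ x • mvfderiv I g₂ x + f₂ x • mvfderiv I g₁ x),
    mvfderiv I g₂ x (X₁ x) - mvfderiv I g₁ x (X₂ x)
      + (1 / 2 : ℝ) * (α₁ x (X₂ x) - α₂ x (X₁ x) - f₂ x * g₁ x + f₁ x * g₂ x)))

/-- `ℰ¹(M)`-Dirac structures. -/
structure IsEOneDirac [IsManifold I ∞ M] (L : ∀ x, Submodule ℝ (EOne I M x)) : Prop where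
  subbundle : IsSubbundle I (EOneModel E) L
  maxIsotropic : ∀ x, IsMaxIsotropic (eonePairing I x) (L x)
  closed : ∀ a b, IsSection I (EOneModel E) L a → IsSection I (EOneModel E) L b →
    IsSection I (EOneModel E) L (eoneBracket I a b)

end Dirac

/-! ### Passage from `M` to `M × ℝ` -/

section Suspension

variable {E : Type*} [NormedAddCommGroup E] [NormedSpace ℝ E]
  {H : Type*} [TopologicalSpace H] (I : ModelWithCorners ℝ E H)
  {M : Type*} [TopologicalSpace M] [ChartedSpace H M]

variable (M) in
/-- The projection `π₁ : M × ℝ → M`. -/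
abbrev timeProj : C^∞⟮I.prod 𝓘(ℝ, ℝ), M × ℝ; I, M⟯ := ContMDiffMap.fst

section

variable {V : M → Type*} [∀ x, AddCommGroup (V x)] [∀ x, Module ℝ (V x)]

/-- The vector bundle `Ā = A × ℝ = π₁^* A` over `M × ℝ`, whose sections are the time-dependent
sections of `A`. -/
def barBundle (A : ∀ x, Submodule ℝ (V x)) (p : M × ℝ) :
    Submodule ℝ ((⇑(timeProj I M) *ᵖ V) p) :=
  A p.1

/-- The bracket `⟦s, t⟧(x, τ) = ⟦s_τ, t_τ⟧(x) + φ(s) ∂t/∂τ - φ(t) ∂s/∂τ` on time-dependent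
sections. -/
def barBracket [∀ x, TopologicalSpace (V x)]
    (br : (∀ x, V x) → (∀ x, V x) → ∀ x, V x) (φ : ∀ x, V x →ₗ[ℝ] ℝ)
    (s t : ∀ p, (⇑(timeProj I M) *ᵖ V) p) (p : M × ℝ) : (⇑(timeProj I M) *ᵖ V) p :=
  let s' : ∀ (x : M) (_ : ℝ), V x := fun x τ ↦ s (x, τ)
  let t' : ∀ (x : M) (_ : ℝ), V x := fun x τ ↦ t (x, τ)
  (br (fun x ↦ s' x p.2) (fun x ↦ t' x p.2) p.1
    + φ p.1 (s' p.1 p.2) • deriv (t' p.1) p.2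
    - φ p.1 (t' p.1 p.2) • deriv (s' p.1) p.2 : V p.1)

/-- The anchor `e ↦ ρ(e) + φ(e) ∂/∂t`, with `T_{(x,t)}(M × ℝ) = T_x M × ℝ`. -/
def barAnchor (ρ : ∀ x, V x →ₗ[ℝ] TangentSpace I x) (φ : ∀ x, V x →ₗ[ℝ] ℝ) (p : M × ℝ) :
    (⇑(timeProj I M) *ᵖ V) p →ₗ[ℝ] TangentSpace (I.prod 𝓘(ℝ, ℝ)) p :=
  ((ρ p.1).prod (φ p.1) : V p.1 →ₗ[ℝ] TangentSpace I p.1 × ℝ)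

end

/-- The map `ψ_{(x,t)} : (u, l) + (α, m) ↦ (u + l ∂/∂t) + e^t (α + m dt)`. -/
def psi (p : M × ℝ) :
    (⇑(timeProj I M) *ᵖ (EOne I M)) p →ₗ[ℝ] Pontryagin (I.prod 𝓘(ℝ, ℝ)) (M × ℝ) p :=
  let ψ : EOne I M p.1 →ₗ[ℝ]
      (TangentSpace I p.1 × ℝ) × ((TangentSpace I p.1 × ℝ) →L[ℝ] ℝ) :=
    { toFun := fun a ↦
        ((a.1.1, a.1.2),
          Real.exp p.2 • (a.2.1.comp (ContinuousLinearMap.fst ℝ (TangentSpace I p.1) ℝ)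
            + a.2.2 • ContinuousLinearMap.snd ℝ (TangentSpace I p.1) ℝ))
      map_add' := fun a b ↦ by
        refine Prod.ext rfl ?_
        ext <;> simp <;> ring
      map_smul' := fun c a ↦ by
        refine Prod.ext rfl ?_
        ext <;> simp <;> ring }
  ψ

/-- The sub-bundle `L̃` of `T(M × ℝ) ⊕ T*(M × ℝ)` associated with `L`, with fibre
`{(u + l ∂/∂t) + e^t (α + m dt) | (u, l) + (α, m) ∈ L_x}`. -/
def tildeBundle (L : ∀ x, Submodule ℝ (EOne I M x)) (p : M × ℝ) :
    Submodule ℝ (Pontryagin (I.prod 𝓘(ℝ, ℝ)) (M × ℝ) p) :=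
  (barBundle I L p).map (psi I p)

end Suspension

end

/-! ### Smooth vector fields and one-forms -/

section Fields

variable {E : Type*} [NormedAddCommGroup E] [NormedSpace ℝ E]
  {H : Type*} [TopologicalSpace H] (I : ModelWithCorners ℝ E H)
  {M : Type*} [TopologicalSpace M] [ChartedSpace H M] [IsManifold I ∞ M]
  {E' : Type*} [NormedAddCommGroup E'] [NormedSpace ℝ E']
  {H' : Type*} [TopologicalSpace H'] (J : ModelWithCorners ℝ E' H')
  {N : Type*} [TopologicalSpace N] [ChartedSpace H' N]

/-- `X` is a smooth vector field along the map `b` at `p`. -/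
abbrev FieldSmoothAt (b : N → M) (X : ∀ p, TangentSpace I (b p)) (p : N) : Prop :=
  ContMDiffAt J (I.prod 𝓘(ℝ, E)) ∞
    (fun q ↦ (TotalSpace.mk' E (b q) (X q) : TotalSpace E (TangentSpace I : M → Type _))) p

/-- `α` is a smooth one-form along the map `b` at `p`. -/
abbrev FormSmoothAt (b : N → M) (α : ∀ p, CotangentSpace I (b p)) (p : N) : Prop :=
  ContMDiffAt J (I.prod 𝓘(ℝ, E →L[ℝ] ℝ)) ∞
    (fun q ↦ (TotalSpace.mk' (E →L[ℝ] ℝ) (b q) (α q) :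
      TotalSpace (E →L[ℝ] ℝ) (CotangentSpace I : M → Type _))) p

/-- `X` is a smooth vector field. -/
abbrev SmoothField (X : ∀ x : M, TangentSpace I x) : Prop :=
  ContMDiff I (I.prod 𝓘(ℝ, E)) ∞
    (fun q ↦ (TotalSpace.mk' E q (X q) : TotalSpace E (TangentSpace I : M → Type _)))

/-- `α` is a smooth one-form. -/
abbrev SmoothForm (α : ∀ x : M, CotangentSpace I x) : Prop :=
  ContMDiff I (I.prod 𝓘(ℝ, E →L[ℝ] ℝ)) ∞
    (fun q ↦ (TotalSpace.mk' (E →L[ℝ] ℝ) q (α q) :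
      TotalSpace (E →L[ℝ] ℝ) (CotangentSpace I : M → Type _)))

variable {I J}

theorem FormSmoothAt.apply {b : N → M} {α : ∀ p, CotangentSpace I (b p)}
    {X : ∀ p, TangentSpace I (b p)} {p : N} (hα : FormSmoothAt I J b α p)
    (hX : FieldSmoothAt I J b X p) : ContMDiffAt J 𝓘(ℝ, ℝ) ∞ (fun q ↦ α q (X q)) p := by
  have h := ContMDiffAt.clm_bundle_apply (E₂ := fun _ : M ↦ ℝ) (F₂ := ℝ) hα hX
  exact (contMDiffAt_totalSpace.1 h).2

theorem SmoothForm.apply {α : ∀ x : M, CotangentSpace I x} {X : ∀ x : M, TangentSpace I x}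
    (hα : SmoothForm I α) (hX : SmoothField I X) :
    ContMDiff I 𝓘(ℝ, ℝ) ∞ (fun x ↦ α x (X x)) :=
  fun x ↦ FormSmoothAt.apply (hα x) (hX x)

variable [FiniteDimensional ℝ E]

theorem exists_smoothField_eventuallyEq_extend [T2Space M] (x : M) (v : TangentSpace I x) :
    ∃ Z : ∀ y : M, TangentSpace I y, SmoothField I Z ∧
      ∀ᶠ y in 𝓝 x, Z y = FiberBundle.extend E v y := by
  obtain ⟨s, hs, hsm⟩ := FiberBundle.exists_contMDiffOn_extend (k := ∞) I E v
  obtain ⟨f, -, hf⟩ := (SmoothBumpFunction.nhds_basis_tsupport (I := I) x).mem_iff.1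
    (interior_mem_nhds.2 hs)
  refine ⟨fun y ↦ f y • FiberBundle.extend E v y,
    ContMDiffOn.smul_section_of_tsupport f.contMDiff.contMDiffOn isOpen_interior hf
      (hsm.mono interior_subset), ?_⟩
  filter_upwards [f.eventuallyEq_one] with y hy
  simp [hy]

theorem exists_smoothField_eq [T2Space M] (x : M) (v : TangentSpace I x) :
    ∃ Z : ∀ y : M, TangentSpace I y, SmoothField I Z ∧ Z x = v := by
  obtain ⟨Z, hZ, h⟩ := exists_smoothField_eventuallyEq_extend x v
  exact ⟨Z, hZ, h.self_of_nhds.trans (FiberBundle.extend_apply_self _ _)⟩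

theorem cotangent_ext [T2Space M] {x : M} {α β : CotangentSpace I x}
    (h : ∀ Z : ∀ y : M, TangentSpace I y, SmoothField I Z → α (Z x) = β (Z x)) : α = β := by
  ext v
  obtain ⟨Z, hZ, rfl⟩ := exists_smoothField_eq x v
  exact h Z hZ

theorem contMDiffAt_clm_of_apply {F : Type*} [NormedAddCommGroup F] [NormedSpace ℝ F]
    {f : N → E →L[ℝ] F} {p : N}
    (h : ∀ w, ContMDiffAt J 𝓘(ℝ, F) ∞ (fun q ↦ f q w) p) :
    ContMDiffAt J 𝓘(ℝ, E →L[ℝ] F) ∞ f p := by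
  let c := Module.finBasis ℝ E
  have hf : f = fun q ↦ ∑ i, (ContinuousLinearMap.smulRightL ℝ E F
      (LinearMap.toContinuousLinearMap (c.coord i))) (f q (c i)) := by
    funext q
    ext w
    conv_lhs => rw [← c.sum_repr w, map_sum]
    simp [-Module.Basis.sum_repr]
  rw [hf]
  refine ContMDiffAt.sum fun i _ ↦ ?_
  exact (ContinuousLinearMap.contMDiff _).contMDiffAt.comp p (h (c i))

/-- A one-form along `b` is smooth if its values on all smooth vector fields are smooth. -/
theorem formSmoothAt_of_apply [T2Space M] {b : N → M} {α : ∀ p, CotangentSpace I (b p)} {p : N}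
    (hb : ContMDiffAt J I ∞ b p)
    (h : ∀ Z : ∀ y : M, TangentSpace I y, SmoothField I Z →
      ContMDiffAt J 𝓘(ℝ, ℝ) ∞ (fun q ↦ α q (Z (b q))) p) : FormSmoothAt I J b α p := by
  refine (contMDiffAt_hom_bundle _).2 ⟨hb, contMDiffAt_clm_of_apply fun w ↦ ?_⟩
  let e := trivializationAt E (TangentSpace I) (b p)
  obtain ⟨Z, hZ, hZe⟩ := exists_smoothField_eventuallyEq_extend (b p) (e.symm (b p) w)
  refine (h Z hZ).congr_of_eventuallyEq ?_
  filter_upwards [hb.continuousAt.eventually hZe, hb.continuousAt.eventually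
    (e.open_baseSet.mem_nhds (FiberBundle.mem_baseSet_trivializationAt' (b p)))] with q hq hqe
  rw [hq]
  have hw : (e ⟨b p, e.symm (b p) w⟩).2 = w := by
    rw [e.apply_mk_symm (FiberBundle.mem_baseSet_trivializationAt' (b p))]
  have hx : FiberBundle.extend E (e.symm (b p) w) (b q) =
      e.symm (b q) (e ⟨b p, e.symm (b p) w⟩).2 := rfl
  rw [hx, hw, ContinuousLinearMap.inCoordinates]
  have hs : (trivializationAt E (TangentSpace I) (b p)).symmL ℝ (b q) w = e.symm (b q) w :=
    e.symmₗ_apply (R := ℝ) hqe w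
  simp [hs]

theorem smoothForm_of_apply [T2Space M] {α : ∀ x : M, CotangentSpace I x}
    (h : ∀ Z : ∀ y : M, TangentSpace I y, SmoothField I Z →
      ContMDiff I 𝓘(ℝ, ℝ) ∞ (fun x ↦ α x (Z x))) : SmoothForm I α :=
  fun x ↦ formSmoothAt_of_apply (b := fun y ↦ y) contMDiffAt_id fun Z hZ ↦ h Z hZ x

end Fields

/-! ### Lie brackets and Lie derivatives in charts -/

section Chart

variable {E : Type*} [NormedAddCommGroup E] [NormedSpace ℝ E] [FiniteDimensional ℝ E]
  {H : Type*} [TopologicalSpace H] {I : ModelWithCorners ℝ E H} [I.Boundaryless]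
  {M : Type*} [TopologicalSpace M] [ChartedSpace H M] [IsManifold I ∞ M] {x : M}

omit [FiniteDimensional ℝ E] [I.Boundaryless] in
theorem chartField_self (X : ∀ y : M, TangentSpace I y) :
    chartField I x X (extChartAt I x x) = X x := by
  have h : ∀ y, y = x → (X y : E) = (X x : E) := by rintro _ rfl; rfl
  exact (mfderivWithin_extChartAt_symm_inverse_apply (I := I) (x := x)
    (X ((extChartAt I x).symm (extChartAt I x x)) : E)).trans (h _ (extChartAt_to_inv x))

omit [FiniteDimensional ℝ E] [I.Boundaryless] in
theorem chartForm_self (α : ∀ y : M, CotangentSpace I y) :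
    chartForm I x α (extChartAt I x x) = α x := by
  have h : ∀ y, y = x → (α y : E →L[ℝ] ℝ) = (α x : E →L[ℝ] ℝ) := by rintro _ rfl; rfl
  ext v
  have h1 : mfderivWithin 𝓘(ℝ, E) I (extChartAt I x).symm (range I) (extChartAt I x x) v = v :=
    congrArg (fun L : E →L[ℝ] E ↦ L v) (mfderivWithin_range_extChartAt_symm (I := I) (x := x))
  calc chartForm I x α (extChartAt I x x) v
      = (α ((extChartAt I x).symm (extChartAt I x x)) : E →L[ℝ] ℝ)
        (mfderivWithin 𝓘(ℝ, E) I (extChartAt I x).symm (range I) (extChartAt I x x) v) := rfl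
    _ = (α ((extChartAt I x).symm (extChartAt I x x)) : E →L[ℝ] ℝ) v := by
        exact congrArg (α ((extChartAt I x).symm (extChartAt I x x)) : E →L[ℝ] ℝ) h1
    _ = (α x : E →L[ℝ] ℝ) v :=
        congrArg (fun β : E →L[ℝ] ℝ ↦ β v) (h _ (extChartAt_to_inv x))

omit [FiniteDimensional ℝ E] [I.Boundaryless] in
theorem chartForm_apply_chartField (α : ∀ y : M, CotangentSpace I y)
    (X : ∀ y : M, TangentSpace I y) {w : E} (hw : w ∈ (extChartAt I x).target) :
    chartForm I x α w (chartField I x X w) =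
      α ((extChartAt I x).symm w) (X ((extChartAt I x).symm w)) := by
  have h := isInvertible_mfderivWithin_extChartAt_symm (I := I) hw
  exact congrArg (α ((extChartAt I x).symm w))
    (h.self_apply_inverse (X ((extChartAt I x).symm w)))

omit [FiniteDimensional ℝ E] [IsManifold I ∞ M] in
theorem mvfderiv_eq_fderiv_chart {h : M → ℝ} (hh : MDifferentiableAt I 𝓘(ℝ, ℝ) h x)
    (v : TangentSpace I x) :
    mvfderiv I h x v = fderiv ℝ (h ∘ (extChartAt I x).symm) (extChartAt I x x) v := by
  rw [hh.mvfderiv, I.range_eq_univ, fderivWithin_univ]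
  rfl

theorem differentiableAt_chartField {X : ∀ y : M, TangentSpace I y}
    (hX : FieldSmoothAt I I (fun y ↦ y) X x) :
    DifferentiableAt ℝ (chartField I x X) (extChartAt I x x) := by
  have h := MDifferentiableWithinAt.differentiableWithinAt_mpullbackWithin_vectorField
    (I := I) (s := univ) (ContMDiffAt.mdifferentiableAt hX (by simp)).mdifferentiableWithinAt
  rw [preimage_univ, univ_inter] at h
  have h' : DifferentiableWithinAt ℝ (chartField I x X) (range I) (extChartAt I x x) := h
  rwa [I.range_eq_univ, differentiableWithinAt_univ] at h'

omit [FiniteDimensional ℝ E] in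
theorem differentiableAt_chartForm {α : ∀ y : M, CotangentSpace I y}
    (hα : FormSmoothAt I I (fun y ↦ y) α x) :
    DifferentiableAt ℝ (chartForm I x α) (extChartAt I x x) := by
  have h1 := ((contMDiffAt_hom_bundle _).1 hα).2
  have h2 : ContMDiffAt 𝓘(ℝ, E) I ∞ (extChartAt I x).symm (extChartAt I x x) := by
    have := contMDiffWithinAt_extChartAt_symm_range (I := I) (n := ∞) x (mem_extChartAt_target x)
    rwa [I.range_eq_univ, contMDiffWithinAt_univ] at this
  have h3 := ContMDiffAt.comp_of_eq h1 h2 (extChartAt_to_inv x)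
  refine (h3.contDiffAt.differentiableAt (by simp)).congr_of_eventuallyEq ?_
  filter_upwards [extChartAt_target_mem_nhds (I := I) x] with w hw
  have hs : (extChartAt I x).symm w ∈ (chartAt H x).source := by
    rw [← extChartAt_source I]; exact (extChartAt I x).map_target hw
  have h4 := TangentBundle.symmL_trivializationAt (I := I) hs
  rw [(extChartAt I x).right_inv hw] at h4
  ext v
  simp only [Function.comp_apply, ContinuousLinearMap.inCoordinates]
  simp
  have h5 := congrArg (fun L : E →L[ℝ] E ↦ (α ((extChartAt I x).symm w) : E →L[ℝ] ℝ) (L v)) h4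
  exact h5.symm

omit [FiniteDimensional ℝ E] in
theorem mlieBracket_eq_chart (X Y : ∀ y : M, TangentSpace I y) :
    VectorField.mlieBracket I X Y x = VectorField.lieBracket ℝ (chartField I x X)
      (chartField I x Y) (extChartAt I x x) := by
  let A : E →L[ℝ] E := (mfderiv I 𝓘(ℝ, E) (extChartAt I x) x).inverse
  let B : E := VectorField.lieBracketWithin ℝ (chartField I x X) (chartField I x Y)
    ((extChartAt I x).symm ⁻¹' univ ∩ range I) (extChartAt I x x)
  have hA : A = ContinuousLinearMap.id ℝ E :=
    (congrArg (fun L : E →L[ℝ] E ↦ L.inverse) (mfderiv_extChartAt_self (I := I) (x := x))).trans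
      ContinuousLinearMap.inverse_id
  have hB : B = VectorField.lieBracket ℝ (chartField I x X) (chartField I x Y)
      (extChartAt I x x) := by
    simp only [B]
    rw [preimage_univ, univ_inter, I.range_eq_univ, VectorField.lieBracketWithin_univ]
  have h : VectorField.mlieBracket I X Y x = A B := rfl
  rw [h, hA, hB]
  rfl

/-- Cartan's formula `(ℒ_X α)(Y) = X(α(Y)) - α([X, Y])`. -/
theorem lieDerivForm_apply {X Y : ∀ y : M, TangentSpace I y} {α : ∀ y : M, CotangentSpace I y}
    (hX : FieldSmoothAt I I (fun y ↦ y) X x) (hY : FieldSmoothAt I I (fun y ↦ y) Y x)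
    (hα : FormSmoothAt I I (fun y ↦ y) α x) :
    lieDerivForm I X α x (Y x) =
      mvfderiv I (fun y ↦ α y (Y y)) x (X x) - α x (VectorField.mlieBracket I X Y x) := by
  have dX := differentiableAt_chartField hX
  have dY := differentiableAt_chartField hY
  have dα := differentiableAt_chartForm hα
  rw [mvfderiv_eq_fderiv_chart ((hα.apply hY).mdifferentiableAt (by simp)), mlieBracket_eq_chart]
  have h : (fun y ↦ α y (Y y)) ∘ (extChartAt I x).symm =ᶠ[𝓝 (extChartAt I x x)]
      fun w ↦ chartForm I x α w (chartField I x Y w) := by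
    filter_upwards [extChartAt_target_mem_nhds (I := I) x] with w hw
    exact (chartForm_apply_chartField α Y hw).symm
  rw [h.fderiv_eq, fderiv_clm_apply dα dY]
  have h1 : lieDerivForm I X α x (Y x) =
      (fderivWithin ℝ (chartForm I x α) (range I) (extChartAt I x x)
        (chartField I x X (extChartAt I x x))) (Y x : E)
      + (chartForm I x α (extChartAt I x x)).comp
        (fderivWithin ℝ (chartField I x X) (range I) (extChartAt I x x)) (Y x : E) := by
    have := mfderiv_extChartAt_self (I := I) (x := x)
    exact congrArg (fun L : E →L[ℝ] E ↦
      (fderivWithin ℝ (chartForm I x α) (range I) (extChartAt I x x)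
        (chartField I x X (extChartAt I x x))) (L (Y x : E))
      + (chartForm I x α (extChartAt I x x)).comp
        (fderivWithin ℝ (chartField I x X) (range I) (extChartAt I x x)) (L (Y x : E))) this
  rw [h1, I.range_eq_univ, fderivWithin_univ, fderivWithin_univ, VectorField.lieBracket_eq]
  simp only [chartForm_self, chartField_self]
  have key : ∀ (a a' : E) (A : E →L[ℝ] E →L[ℝ] ℝ) (b : E →L[ℝ] ℝ) (P Q : E →L[ℝ] E),
      A a a' + b.comp P a' = (b.comp Q + A.flip a') a - b (Q a - P a') := by
    intros
    simp only [add_apply, ContinuousLinearMap.comp_apply,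
      ContinuousLinearMap.flip_apply, map_sub]
    ring
  exact key _ _ _ _ _ _

omit [FiniteDimensional ℝ E] [I.Boundaryless] in
theorem ContMDiff.mvfderiv_apply {h : M → ℝ} (hh : ContMDiff I 𝓘(ℝ, ℝ) ∞ h)
    {X : ∀ y : M, TangentSpace I y} (hX : SmoothField I X) :
    ContMDiff I 𝓘(ℝ, ℝ) ∞ (fun y ↦ mvfderiv I h y (X y)) := by
  have h1 : ContMDiff I.tangent 𝓘(ℝ, ℝ).tangent ∞ (tangentMap I 𝓘(ℝ, ℝ) h) :=
    hh.contMDiff_tangentMap (by simp)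
  exact (contMDiff_snd_tangentBundle_modelSpace ℝ 𝓘(ℝ, ℝ)).comp (h1.comp hX)

omit [FiniteDimensional ℝ E] in
theorem mvfderiv_apply_chart {h : M → ℝ} (hh : ContMDiff I 𝓘(ℝ, ℝ) ∞ h)
    (X : ∀ y : M, TangentSpace I y) {w : E} (hw : w ∈ (extChartAt I x).target) :
    mvfderiv I h ((extChartAt I x).symm w) (X ((extChartAt I x).symm w)) =
      fderiv ℝ (h ∘ (extChartAt I x).symm) w (chartField I x X w) := by
  have h1 := isInvertible_mfderivWithin_extChartAt_symm (I := I) hw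
  have h2 : mfderivWithin 𝓘(ℝ, E) 𝓘(ℝ, ℝ) (h ∘ (extChartAt I x).symm) (range I) w =
      (mfderiv I 𝓘(ℝ, ℝ) h ((extChartAt I x).symm w)).comp
        (mfderivWithin 𝓘(ℝ, E) I (extChartAt I x).symm (range I) w) :=
    mfderiv_comp_mfderivWithin w (hh.mdifferentiableAt (by simp))
      (mdifferentiableWithinAt_extChartAt_symm hw) (I.uniqueMDiffOn w
        (extChartAt_target_subset_range x hw))
  have h3 : fderiv ℝ (h ∘ (extChartAt I x).symm) w =
      mfderivWithin 𝓘(ℝ, E) 𝓘(ℝ, ℝ) (h ∘ (extChartAt I x).symm) (range I) w := by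
    rw [mfderivWithin_eq_fderivWithin, I.range_eq_univ, fderivWithin_univ]
  have h4 := congrArg (fun L : E →L[ℝ] ℝ ↦ L (chartField I x X w)) (h3.trans h2)
  refine Eq.symm (h4.trans ?_)
  exact congrArg (mfderiv I 𝓘(ℝ, ℝ) h ((extChartAt I x).symm w))
    (h1.self_apply_inverse (X ((extChartAt I x).symm w)))

theorem mvfderiv_mlieBracket {h : M → ℝ} (hh : ContMDiff I 𝓘(ℝ, ℝ) ∞ h)
    {X Y : ∀ y : M, TangentSpace I y} (hX : SmoothField I X) (hY : SmoothField I Y) :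
    mvfderiv I h x (VectorField.mlieBracket I X Y x) =
      mvfderiv I (fun y ↦ mvfderiv I h y (Y y)) x (X x) -
        mvfderiv I (fun y ↦ mvfderiv I h y (X y)) x (Y x) := by
  have key : ∀ {Z W : ∀ y : M, TangentSpace I y}, SmoothField I Z →
      mvfderiv I (fun y ↦ mvfderiv I h y (Z y)) x (W x) =
        fderiv ℝ (fun w ↦ fderiv ℝ (h ∘ (extChartAt I x).symm) w (chartField I x Z w))
          (extChartAt I x x) (chartField I x W (extChartAt I x x)) := by
    intro Z W hZ
    rw [mvfderiv_eq_fderiv_chart ((hh.mvfderiv_apply hZ).mdifferentiableAt (by simp)),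
      chartField_self]
    have he : (fun y ↦ mvfderiv I h y (Z y)) ∘ (extChartAt I x).symm =ᶠ[𝓝 (extChartAt I x x)]
        fun w ↦ fderiv ℝ (h ∘ (extChartAt I x).symm) w (chartField I x Z w) := by
      filter_upwards [extChartAt_target_mem_nhds (I := I) x] with w hw
      exact mvfderiv_apply_chart hh Z hw
    rw [he.fderiv_eq]
  have h2 : ContMDiffAt 𝓘(ℝ, E) I ∞ (extChartAt I x).symm (extChartAt I x x) := by
    have := contMDiffWithinAt_extChartAt_symm_range (I := I) (n := ∞) x (mem_extChartAt_target x)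
    rwa [I.range_eq_univ, contMDiffWithinAt_univ] at this
  have h3 : ContDiffAt ℝ ∞ (h ∘ (extChartAt I x).symm) (extChartAt I x x) :=
    ((hh _).comp _ h2).contDiffAt
  rw [key hX, key hY, mvfderiv_eq_fderiv_chart (hh.mdifferentiableAt (by simp)),
    mlieBracket_eq_chart]
  exact VectorField.fderiv_apply_lieBracket h3
    (by rw [minSmoothness_of_isRCLikeNormedField]; exact ENat.LEInfty.out)
    (differentiableAt_chartField (hY x)) (differentiableAt_chartField (hX x))

omit [I.Boundaryless] in
theorem exists_contMDiff_mvfderiv_eq [T2Space M] (x : M) (l : E →L[ℝ] ℝ) :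
    ∃ h : M → ℝ, ContMDiff I 𝓘(ℝ, ℝ) ∞ h ∧ ∀ v : TangentSpace I x, mvfderiv I h x v = l v := by
  obtain ⟨f⟩ : Nonempty (SmoothBumpFunction I x) := inferInstance
  have hl : ContMDiffOn I 𝓘(ℝ, ℝ) ∞ (l ∘ extChartAt I x) (chartAt H x).source :=
    l.contMDiff.comp_contMDiffOn contMDiffOn_extChartAt
  refine ⟨fun y ↦ f y • (l ∘ extChartAt I x) y, f.contMDiff_smul hl, fun v ↦ ?_⟩
  have he : (fun y ↦ f y • (l ∘ extChartAt I x) y) =ᶠ[𝓝 x] l ∘ extChartAt I x := by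
    filter_upwards [f.eventuallyEq_one] with y hy
    simp [hy]
  have h1 : mfderiv I 𝓘(ℝ, ℝ) (fun y ↦ f y • (l ∘ extChartAt I x) y) x =
      mfderiv I 𝓘(ℝ, ℝ) (l ∘ extChartAt I x) x := he.mfderiv_eq
  have h2 := mfderiv_comp x (l.mdifferentiableAt (x := extChartAt I x x))
    (mdifferentiableAt_extChartAt (I := I) (mem_chart_source H x))
  rw [mfderiv_extChartAt_self] at h2
  have h3 : mfderiv 𝓘(ℝ, E) 𝓘(ℝ, ℝ) l (extChartAt I x x) = l := l.mfderiv_eq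
  have h4 : (mfderiv I 𝓘(ℝ, ℝ) (l ∘ extChartAt I x) x : E →L[ℝ] ℝ) =
      (mfderiv 𝓘(ℝ, E) 𝓘(ℝ, ℝ) l (extChartAt I x x) : E →L[ℝ] ℝ).comp
        (ContinuousLinearMap.id ℝ E) := h2
  exact congrArg (fun L : E →L[ℝ] ℝ ↦ L v) ((h1.trans h4).trans
    (congrArg (fun L : E →L[ℝ] ℝ ↦ L.comp (ContinuousLinearMap.id ℝ E)) h3))

omit [I.Boundaryless] in
theorem tangent_ext [T2Space M] {x : M} {v w : TangentSpace I x}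
    (h : ∀ f : M → ℝ, ContMDiff I 𝓘(ℝ, ℝ) ∞ f → mvfderiv I f x v = mvfderiv I f x w) : v = w := by
  by_contra hvw
  obtain ⟨l, hl⟩ := SeparatingDual.exists_separating_of_ne (R := ℝ) (V := E) hvw
  obtain ⟨f, hf, hfl⟩ := exists_contMDiff_mvfderiv_eq (I := I) x l
  exact hl ((hfl v).symm.trans ((h f hf).trans (hfl w)))

omit [I.Boundaryless] in
theorem SmoothField.mlieBracket {X Y : ∀ y : M, TangentSpace I y} (hX : SmoothField I X)
    (hY : SmoothField I Y) : SmoothField I (VectorField.mlieBracket I X Y) := fun x ↦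
  haveI : IsManifold I (minSmoothness ℝ 2) M := by
    rw [minSmoothness_of_isRCLikeNormedField]; infer_instance
  haveI : IsManifold I (((⊤ : ℕ∞) : WithTop ℕ∞) + 1) M := inferInstanceAs (IsManifold I ∞ M)
  ContMDiffAt.mlieBracket_vectorField (n := (⊤ : ℕ∞)) (m := (⊤ : ℕ∞)) (hX x) (hY x) (by simp)

omit [I.Boundaryless] in
theorem SmoothForm.mvfderiv [T2Space M] {h : M → ℝ} (hh : ContMDiff I 𝓘(ℝ, ℝ) ∞ h) :
    SmoothForm I (_root_.mvfderiv I h) :=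
  smoothForm_of_apply fun _ hZ ↦ hh.mvfderiv_apply hZ

end Chart

/-! ### Smooth sections of direct sums, trivial bundles and pullbacks -/

section BundleSections

variable {EB : Type*} [NormedAddCommGroup EB] [NormedSpace ℝ EB]
  {HB : Type*} [TopologicalSpace HB] {I : ModelWithCorners ℝ EB HB}
  {B : Type*} [TopologicalSpace B] [ChartedSpace HB B]
  {E' : Type*} [NormedAddCommGroup E'] [NormedSpace ℝ E']
  {H' : Type*} [TopologicalSpace H'] {J : ModelWithCorners ℝ E' H'}
  {N : Type*} [TopologicalSpace N] [ChartedSpace H' N]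
  {F₁ : Type*} [NormedAddCommGroup F₁] [NormedSpace ℝ F₁]
  {V₁ : B → Type*} [TopologicalSpace (TotalSpace F₁ V₁)] [∀ x, TopologicalSpace (V₁ x)]
  [FiberBundle F₁ V₁]
  {F₂ : Type*} [NormedAddCommGroup F₂] [NormedSpace ℝ F₂]
  {V₂ : B → Type*} [TopologicalSpace (TotalSpace F₂ V₂)] [∀ x, TopologicalSpace (V₂ x)]
  [FiberBundle F₂ V₂]

theorem contMDiffAt_prodBundle_iff [∀ x, Zero (V₁ x)] [∀ x, Zero (V₂ x)] {b : N → B}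
    {v₁ : ∀ q, V₁ (b q)} {v₂ : ∀ q, V₂ (b q)} {p : N} :
    ContMDiffAt J (I.prod 𝓘(ℝ, F₁ × F₂)) ∞ (fun q ↦ (TotalSpace.mk' (F₁ × F₂) (b q) (v₁ q, v₂ q) :
      TotalSpace (F₁ × F₂) (V₁ ×ᵇ V₂))) p ↔
    ContMDiffAt J (I.prod 𝓘(ℝ, F₁)) ∞ (fun q ↦ TotalSpace.mk' F₁ (b q) (v₁ q)) p ∧
    ContMDiffAt J (I.prod 𝓘(ℝ, F₂)) ∞ (fun q ↦ TotalSpace.mk' F₂ (b q) (v₂ q)) p := by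
  rw [contMDiffAt_totalSpace, contMDiffAt_totalSpace, contMDiffAt_totalSpace]
  have h : ContMDiffAt J 𝓘(ℝ, F₁ × F₂) ∞ (fun q ↦ (trivializationAt (F₁ × F₂) (V₁ ×ᵇ V₂) (b p)
      (TotalSpace.mk' (F₁ × F₂) (b q) (v₁ q, v₂ q))).2) p ↔
      ContMDiffAt J 𝓘(ℝ, F₁) ∞
        (fun q ↦ (trivializationAt F₁ V₁ (b p) (TotalSpace.mk' F₁ (b q) (v₁ q))).2) p ∧
      ContMDiffAt J 𝓘(ℝ, F₂) ∞
        (fun q ↦ (trivializationAt F₂ V₂ (b p) (TotalSpace.mk' F₂ (b q) (v₂ q))).2) p :=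
    contMDiffAt_prod_module_iff _
  constructor
  · rintro ⟨hb, hv⟩
    exact ⟨⟨hb, (h.1 hv).1⟩, hb, (h.1 hv).2⟩
  · rintro ⟨⟨hb, h1⟩, -, h2⟩
    exact ⟨hb, h.2 ⟨h1, h2⟩⟩

theorem contMDiffAt_trivialBundle_iff {F : Type*} [NormedAddCommGroup F] [NormedSpace ℝ F]
    {b : N → B} {g : N → F} {p : N} :
    ContMDiffAt J (I.prod 𝓘(ℝ, F)) ∞
      (fun q ↦ (TotalSpace.mk' F (b q) (g q) : TotalSpace F (Bundle.Trivial B F))) p ↔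
    ContMDiffAt J I ∞ b p ∧ ContMDiffAt J 𝓘(ℝ, F) ∞ g p :=
  contMDiffAt_totalSpace

theorem contMDiffAt_pullback_iff [∀ x, AddCommMonoid (V₁ x)] (f : ContMDiffMap J I N B ∞)
    {s : ∀ q, (⇑f *ᵖ V₁) q} {p : N} :
    ContMDiffAt J (J.prod 𝓘(ℝ, F₁)) ∞
      (fun q ↦ (TotalSpace.mk' F₁ q (s q) : TotalSpace F₁ (⇑f *ᵖ V₁))) p ↔
    ContMDiffAt J (I.prod 𝓘(ℝ, F₁)) ∞
      (fun q ↦ (TotalSpace.mk' F₁ (f q) (s q) : TotalSpace F₁ V₁)) p := by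
  rw [contMDiffAt_totalSpace, contMDiffAt_totalSpace]
  constructor
  · rintro ⟨-, h⟩
    exact ⟨f.contMDiff p, h⟩
  · rintro ⟨-, h⟩
    exact ⟨contMDiffAt_id, h⟩

end BundleSections

section SubbundleSections

variable {EB : Type*} [NormedAddCommGroup EB] [NormedSpace ℝ EB]
  {HB : Type*} [TopologicalSpace HB] {I : ModelWithCorners ℝ EB HB}
  {B : Type*} [TopologicalSpace B] [ChartedSpace HB B]
  {F : Type*} [NormedAddCommGroup F] [NormedSpace ℝ F]
  {V : B → Type*} [TopologicalSpace (TotalSpace F V)] [∀ x, AddCommGroup (V x)]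
  [∀ x, Module ℝ (V x)] [∀ x, TopologicalSpace (V x)] [FiberBundle F V] [VectorBundle ℝ F V]
  {A : ∀ x, Submodule ℝ (V x)} {s t : ∀ x, V x}

theorem IsSection.add (hs : IsSection I F A s) (ht : IsSection I F A t) :
    IsSection I F A (s + t) :=
  ⟨hs.smooth.add_section ht.smooth, fun x ↦ (A x).add_mem (hs.mem x) (ht.mem x)⟩

theorem IsSection.smul {f : B → ℝ} (hf : ContMDiff I 𝓘(ℝ, ℝ) ∞ f) (hs : IsSection I F A s) :
    IsSection I F A (fun y ↦ f y • s y) :=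
  ⟨hf.smul_section hs.smooth, fun x ↦ (A x).smul_mem _ (hs.mem x)⟩

end SubbundleSections

/-! ### The Lie algebroid of a Dirac structure -/

section DiracAlgebroid

variable {E : Type*} [NormedAddCommGroup E] [NormedSpace ℝ E]
  {H : Type*} [TopologicalSpace H] {I : ModelWithCorners ℝ E H}
  {M : Type*} [TopologicalSpace M] [ChartedSpace H M] [IsManifold I ∞ M]

theorem contMDiffAt_pontryagin_iff {a : ∀ x, Pontryagin I M x} {x : M} :
    ContMDiffAt I (I.prod 𝓘(ℝ, PontryaginModel E)) ∞
      (fun y ↦ TotalSpace.mk' (PontryaginModel E) y (a y)) x ↔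
    FieldSmoothAt I I (fun y ↦ y) (fun y ↦ (a y).1) x ∧
      FormSmoothAt I I (fun y ↦ y) (fun y ↦ (a y).2) x :=
  contMDiffAt_prodBundle_iff (b := fun y : M ↦ y) (v₁ := fun y ↦ (a y).1) (v₂ := fun y ↦ (a y).2)

section

variable {L : ∀ x, Submodule ℝ (Pontryagin I M x)} {a : ∀ x, Pontryagin I M x}

theorem IsSection.field (ha : IsSection I (PontryaginModel E) L a) :
    SmoothField I (fun y ↦ (a y).1) :=
  fun x ↦ (contMDiffAt_pontryagin_iff.1 (ha.smooth x)).1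

theorem IsSection.form (ha : IsSection I (PontryaginModel E) L a) :
    SmoothForm I (fun y ↦ (a y).2) :=
  fun x ↦ (contMDiffAt_pontryagin_iff.1 (ha.smooth x)).2

end

variable [FiniteDimensional ℝ E] [I.Boundaryless] {x : M}

theorem courantBracket_snd_apply {a b : ∀ x, Pontryagin I M x} {Z : ∀ x : M, TangentSpace I x}
    (ha₁ : SmoothField I (fun y ↦ (a y).1)) (ha₂ : SmoothForm I (fun y ↦ (a y).2))
    (hb₁ : SmoothField I (fun y ↦ (b y).1)) (hb₂ : SmoothForm I (fun y ↦ (b y).2))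
    (hZ : SmoothField I Z) :
    (courantBracket I a b x).2 (Z x) =
      (mvfderiv I (fun y ↦ (b y).2 (Z y)) x (a x).1
        - (b x).2 (VectorField.mlieBracket I (fun y ↦ (a y).1) Z x))
      - (mvfderiv I (fun y ↦ (a y).2 (Z y)) x (b x).1
        - (a x).2 (VectorField.mlieBracket I (fun y ↦ (b y).1) Z x))
      + (1 / 2 : ℝ) * mvfderiv I (fun y ↦ (a y).2 (b y).1 - (b y).2 (a y).1) x (Z x) := by
  rw [← lieDerivForm_apply (ha₁ x) (hZ x) (hb₂ x), ← lieDerivForm_apply (hb₁ x) (hZ x) (ha₂ x)]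
  rfl

theorem contMDiff_courantBracket [T2Space M] {a b : ∀ x, Pontryagin I M x}
    (ha₁ : SmoothField I (fun y ↦ (a y).1)) (ha₂ : SmoothForm I (fun y ↦ (a y).2))
    (hb₁ : SmoothField I (fun y ↦ (b y).1)) (hb₂ : SmoothForm I (fun y ↦ (b y).2)) :
    ContMDiff I (I.prod 𝓘(ℝ, PontryaginModel E)) ∞
      (fun y ↦ TotalSpace.mk' (PontryaginModel E) y (courantBracket I a b y)) := by
  intro x
  refine contMDiffAt_pontryagin_iff.2 ⟨ha₁.mlieBracket hb₁ x, ?_⟩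
  refine smoothForm_of_apply (α := fun y ↦ (courantBracket I a b y).2) (fun Z hZ ↦ ?_) x
  simp only [courantBracket_snd_apply ha₁ ha₂ hb₁ hb₂ hZ]
  exact (((hb₂.apply hZ).mvfderiv_apply ha₁).sub (hb₂.apply (ha₁.mlieBracket hZ))).sub
    (((ha₂.apply hZ).mvfderiv_apply hb₁).sub (ha₂.apply (hb₁.mlieBracket hZ))) |>.add
    (contMDiff_const.mul (((ha₂.apply hb₁).sub (hb₂.apply ha₁)).mvfderiv_apply hZ))

/-- On sections which are orthogonal for the pairing, the Courant bracket is
`[X, Y] + ℒ_X β - ℒ_Y α + d(α(Y))`. -/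
theorem courantBracket_snd_apply_of_isotropic {a b : ∀ x, Pontryagin I M x}
    {Z : ∀ x : M, TangentSpace I x}
    (ha₁ : SmoothField I (fun y ↦ (a y).1)) (ha₂ : SmoothForm I (fun y ↦ (a y).2))
    (hb₁ : SmoothField I (fun y ↦ (b y).1)) (hb₂ : SmoothForm I (fun y ↦ (b y).2))
    (hZ : SmoothField I Z) (hab : ∀ y, (b y).2 (a y).1 = -(a y).2 (b y).1) :
    (courantBracket I a b x).2 (Z x) =
      mvfderiv I (fun y ↦ (b y).2 (Z y)) x (a x).1
        - (b x).2 (VectorField.mlieBracket I (fun y ↦ (a y).1) Z x)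
      - mvfderiv I (fun y ↦ (a y).2 (Z y)) x (b x).1
        + (a x).2 (VectorField.mlieBracket I (fun y ↦ (b y).1) Z x)
      + mvfderiv I (fun y ↦ (a y).2 (b y).1) x (Z x) := by
  have h : mvfderiv I (fun y ↦ (a y).2 (b y).1 - (b y).2 (a y).1) x (Z x) =
      2 * mvfderiv I (fun y ↦ (a y).2 (b y).1) x (Z x) := by
    have hs := (ha₂.apply hb₁).mdifferentiableAt (x := x) (by simp)
    have h' : (fun y ↦ (a y).2 (b y).1 - (b y).2 (a y).1) =
        (fun y ↦ (a y).2 (b y).1) + fun y ↦ (a y).2 (b y).1 := by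
      funext y
      simp [hab y]
    rw [h', mvfderiv_add hs hs, add_apply]
    ring
  rw [courantBracket_snd_apply ha₁ ha₂ hb₁ hb₂ hZ, h]
  ring

omit [IsManifold I ∞ M] [FiniteDimensional ℝ E] [I.Boundaryless] in
theorem mvfderiv_fun_neg_apply {f : M → ℝ} (v : TangentSpace I x) :
    mvfderiv I (fun y ↦ -f y) x v = -mvfderiv I f x v := by
  have := mvfderiv_neg (I := I) (g := f) (x := x)
  exact congrArg (fun L : TangentSpace I x →L[ℝ] ℝ ↦ L v) this

omit [IsManifold I ∞ M] [FiniteDimensional ℝ E] [I.Boundaryless] in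
theorem mvfderiv_fun_mul_apply {f g : M → ℝ} (hf : MDifferentiableAt I 𝓘(ℝ, ℝ) f x)
    (hg : MDifferentiableAt I 𝓘(ℝ, ℝ) g x) (v : TangentSpace I x) :
    mvfderiv I (fun y ↦ f y * g y) x v = f x * mvfderiv I g x v + g x * mvfderiv I f x v := by
  have := mvfderiv_mul (I := I) hf hg
  exact congrArg (fun L : TangentSpace I x →L[ℝ] ℝ ↦ L v) this

omit [IsManifold I ∞ M] [FiniteDimensional ℝ E] [I.Boundaryless] in
theorem mvfderiv_fun_add_apply {f g : M → ℝ} (hf : MDifferentiableAt I 𝓘(ℝ, ℝ) f x)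
    (hg : MDifferentiableAt I 𝓘(ℝ, ℝ) g x) (v : TangentSpace I x) :
    mvfderiv I (fun y ↦ f y + g y) x v = mvfderiv I f x v + mvfderiv I g x v :=
  congrArg (fun L : TangentSpace I x →L[ℝ] ℝ ↦ L v) (mvfderiv_add hf hg)

omit [IsManifold I ∞ M] [FiniteDimensional ℝ E] [I.Boundaryless] in
theorem mvfderiv_fun_sub_apply {f g : M → ℝ} (hf : MDifferentiableAt I 𝓘(ℝ, ℝ) f x)
    (hg : MDifferentiableAt I 𝓘(ℝ, ℝ) g x) (v : TangentSpace I x) :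
    mvfderiv I (fun y ↦ f y - g y) x v = mvfderiv I f x v - mvfderiv I g x v :=
  congrArg (fun L : TangentSpace I x →L[ℝ] ℝ ↦ L v) (mvfderiv_sub hf hg)

/-- The derivative `V(f)` of a function along a vector field. -/
noncomputable def fieldDeriv (V : ∀ x : M, TangentSpace I x) (f : M → ℝ) : M → ℝ :=
  fun x ↦ mvfderiv I f x (V x)

/-- The function `α(V)`. -/
noncomputable def formApply (α : ∀ x : M, CotangentSpace I x) (V : ∀ x : M, TangentSpace I x) :
    M → ℝ :=
  fun x ↦ α x (V x)

section FieldDeriv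

variable {f g : M → ℝ} {V W : ∀ x : M, TangentSpace I x} {α : ∀ x : M, CotangentSpace I x}

omit [IsManifold I ∞ M] [FiniteDimensional ℝ E] [I.Boundaryless] in
theorem fieldDeriv_add (hf : ContMDiff I 𝓘(ℝ, ℝ) ∞ f) (hg : ContMDiff I 𝓘(ℝ, ℝ) ∞ g) :
    fieldDeriv V (f + g) = fieldDeriv V f + fieldDeriv V g :=
  funext fun _ ↦ mvfderiv_fun_add_apply (hf.mdifferentiableAt (by simp))
    (hg.mdifferentiableAt (by simp)) _

omit [IsManifold I ∞ M] [FiniteDimensional ℝ E] [I.Boundaryless] in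
theorem fieldDeriv_sub (hf : ContMDiff I 𝓘(ℝ, ℝ) ∞ f) (hg : ContMDiff I 𝓘(ℝ, ℝ) ∞ g) :
    fieldDeriv V (f - g) = fieldDeriv V f - fieldDeriv V g :=
  funext fun _ ↦ mvfderiv_fun_sub_apply (hf.mdifferentiableAt (by simp))
    (hg.mdifferentiableAt (by simp)) _

omit [IsManifold I ∞ M] [FiniteDimensional ℝ E] [I.Boundaryless] in
theorem fieldDeriv_neg : fieldDeriv V (-f) = -fieldDeriv V f :=
  funext fun _ ↦ mvfderiv_fun_neg_apply _

omit [FiniteDimensional ℝ E] [I.Boundaryless] in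
theorem contMDiff_fieldDeriv (hV : SmoothField I V) (hf : ContMDiff I 𝓘(ℝ, ℝ) ∞ f) :
    ContMDiff I 𝓘(ℝ, ℝ) ∞ (fieldDeriv V f) :=
  hf.mvfderiv_apply hV

theorem fieldDeriv_mlieBracket (hV : SmoothField I V) (hW : SmoothField I W)
    (hf : ContMDiff I 𝓘(ℝ, ℝ) ∞ f) :
    fieldDeriv (VectorField.mlieBracket I V W) f =
      fieldDeriv V (fieldDeriv W f) - fieldDeriv W (fieldDeriv V f) :=
  funext fun _ ↦ mvfderiv_mlieBracket hf hV hW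

end FieldDeriv

section Algebroid

variable {L : ∀ x, Submodule ℝ (Pontryagin I M x)} {a b c : ∀ x, Pontryagin I M x}

omit [FiniteDimensional ℝ E] [I.Boundaryless] in
theorem IsDirac.isotropic (hL : IsDirac I L) {x : M} {u v : Pontryagin I M x} (hu : u ∈ L x)
    (hv : v ∈ L x) : v.2 u.1 = -u.2 v.1 := by
  have h : (1 / 2 : ℝ) * (u.2 v.1 + v.2 u.1) = 0 := (hL.maxIsotropic x).prop u hu v hv
  linarith

variable [T2Space M]

theorem IsDirac.courantBracket_add_left (hL : IsDirac I L)
    (ha : IsSection I (PontryaginModel E) L a) (hb : IsSection I (PontryaginModel E) L b)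
    (hc : IsSection I (PontryaginModel E) L c) (hab : IsSection I (PontryaginModel E) L (a + b)) :
    courantBracket I (a + b) c = courantBracket I a c + courantBracket I b c := by
  funext x
  have hl : ∀ Z : ∀ x : M, TangentSpace I x, VectorField.mlieBracket I (fun y ↦ ((a + b) y).1) Z x =
      VectorField.mlieBracket I (fun y ↦ (a y).1) Z x +
      VectorField.mlieBracket I (fun y ↦ (b y).1) Z x := fun Z ↦
    VectorField.mlieBracket_add_left ((ha.field x).mdifferentiableAt (by simp))
      ((hb.field x).mdifferentiableAt (by simp))
  refine Prod.ext (hl _) (cotangent_ext (I := I) fun Z hZ ↦ ?_)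
  have h₁ := fun {a} (ha : IsSection I (PontryaginModel E) L a) ↦
    courantBracket_snd_apply_of_isotropic (x := x) ha.field ha.form hc.field hc.form hZ
      fun y ↦ hL.isotropic (ha.mem y) (hc.mem y)
  have h₂ : ((courantBracket I a c + courantBracket I b c) x).2 (Z x) =
    (courantBracket I a c x).2 (Z x) + (courantBracket I b c x).2 (Z x) := rfl
  have h₃ : ∀ X : ∀ x : M, TangentSpace I x, SmoothField I X → ∀ v : TangentSpace I x,
      mvfderiv I (fun y ↦ ((a + b) y).2 (X y)) x v =
      mvfderiv I (fun y ↦ (a y).2 (X y)) x v + mvfderiv I (fun y ↦ (b y).2 (X y)) x v :=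
    fun X hX v ↦ mvfderiv_fun_add_apply ((ha.form.apply hX).mdifferentiableAt (by simp))
      ((hb.form.apply hX).mdifferentiableAt (by simp)) v
  have h₄ : ((a + b) x).1 = (a x).1 + (b x).1 := rfl
  have h₅ : ∀ v, ((a + b) x).2 v = (a x).2 v + (b x).2 v := fun _ ↦ rfl
  rw [h₂, h₁ ha, h₁ hb, h₁ hab, hl, h₃ _ hZ, h₃ _ hc.field, h₄, h₅, map_add, map_add]
  ring

theorem IsDirac.courantBracket_skew (hL : IsDirac I L)
    (ha : IsSection I (PontryaginModel E) L a) (hb : IsSection I (PontryaginModel E) L b) :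
    courantBracket I a b + courantBracket I b a = 0 := by
  funext x
  refine Prod.ext ?_ (cotangent_ext (I := I) fun Z hZ ↦ ?_)
  · change VectorField.mlieBracket I (fun y ↦ (a y).1) (fun y ↦ (b y).1) x +
      VectorField.mlieBracket I (fun y ↦ (b y).1) (fun y ↦ (a y).1) x = 0
    rw [VectorField.mlieBracket_swap_apply, neg_add_cancel]
  · change (courantBracket I a b x).2 (Z x) + (courantBracket I b a x).2 (Z x) = 0
    rw [courantBracket_snd_apply_of_isotropic ha.field ha.form hb.field hb.form hZ
      fun y ↦ hL.isotropic (ha.mem y) (hb.mem y),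
      courantBracket_snd_apply_of_isotropic hb.field hb.form ha.field ha.form hZ
      fun y ↦ hL.isotropic (hb.mem y) (ha.mem y)]
    have h : (fun y ↦ (b y).2 (a y).1) = fun y ↦ -(a y).2 (b y).1 :=
      funext fun y ↦ hL.isotropic (ha.mem y) (hb.mem y)
    rw [h, mvfderiv_fun_neg_apply]
    ring

theorem IsDirac.courantBracket_leibniz (hL : IsDirac I L) {f : M → ℝ}
    (hf : ContMDiff I 𝓘(ℝ, ℝ) ∞ f) (ha : IsSection I (PontryaginModel E) L a)
    (hb : IsSection I (PontryaginModel E) L b)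
    (hfb : IsSection I (PontryaginModel E) L (fun y ↦ f y • b y)) (x : M) :
    courantBracket I a (fun y ↦ f y • b y) x =
      f x • courantBracket I a b x + mvfderiv I f x (a x).1 • b x := by
  have hfx : MDifferentiableAt I 𝓘(ℝ, ℝ) f x := hf.mdifferentiableAt (by simp)
  have hbx := (hb.field x).mdifferentiableAt (by simp)
  refine Prod.ext ?_ (cotangent_ext (I := I) fun Z hZ ↦ ?_)
  · exact (VectorField.mlieBracket_smul_right hfx hbx).trans (add_comm _ _)
  · have h₁ : (f x • courantBracket I a b x + mvfderiv I f x (a x).1 • b x).2 (Z x) =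
        f x * (courantBracket I a b x).2 (Z x) + mvfderiv I f x (a x).1 * (b x).2 (Z x) := rfl
    have h₂ : VectorField.mlieBracket I (fun y ↦ (f y • b y).1) Z x =
        -mvfderiv I f x (Z x) • (b x).1 +
          f x • VectorField.mlieBracket I (fun y ↦ (b y).1) Z x :=
      VectorField.mlieBracket_smul_left hfx hbx
    rw [h₁, courantBracket_snd_apply_of_isotropic ha.field ha.form hfb.field hfb.form hZ
      fun y ↦ hL.isotropic (ha.mem y) (hfb.mem y),
      courantBracket_snd_apply_of_isotropic ha.field ha.form hb.field hb.form hZ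
      fun y ↦ hL.isotropic (ha.mem y) (hb.mem y), h₂]
    have h₃ : ∀ v : TangentSpace I x, mvfderiv I (fun y ↦ (f y • b y).2 (Z y)) x v =
        f x * mvfderiv I (fun y ↦ (b y).2 (Z y)) x v + (b x).2 (Z x) * mvfderiv I f x v :=
      mvfderiv_fun_mul_apply hfx ((hb.form.apply hZ).mdifferentiableAt (by simp))
    have h₄ : ∀ v : TangentSpace I x, mvfderiv I (fun y ↦ (a y).2 (f y • b y).1) x v =
        f x * mvfderiv I (fun y ↦ (a y).2 (b y).1) x v + (a x).2 (b x).1 * mvfderiv I f x v := by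
      have h : (fun y ↦ (a y).2 (f y • b y).1) = fun y ↦ f y * (a y).2 (b y).1 :=
        funext fun y ↦ map_smul (a y).2 (f y) (b y).1
      rw [h]
      exact mvfderiv_fun_mul_apply hfx ((ha.form.apply hb.field).mdifferentiableAt (by simp))
    have h₅ : (f x • b x).1 = f x • (b x).1 := rfl
    have h₆ : ∀ v, (f x • b x).2 v = f x * (b x).2 v := fun _ ↦ rfl
    rw [h₃, h₄, h₅, h₆]
    simp only [map_add, map_smul, smul_eq_mul]
    ring

omit [T2Space M] in
theorem IsDirac.formApply_courantBracket (hL : IsDirac I L) {Z : ∀ x : M, TangentSpace I x}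
    (ha : IsSection I (PontryaginModel E) L a) (hb : IsSection I (PontryaginModel E) L b)
    (hZ : SmoothField I Z) :
    formApply (fun y ↦ (courantBracket I a b y).2) Z =
      fieldDeriv (fun y ↦ (a y).1) (formApply (fun y ↦ (b y).2) Z)
      - formApply (fun y ↦ (b y).2) (VectorField.mlieBracket I (fun y ↦ (a y).1) Z)
      - fieldDeriv (fun y ↦ (b y).1) (formApply (fun y ↦ (a y).2) Z)
      + formApply (fun y ↦ (a y).2) (VectorField.mlieBracket I (fun y ↦ (b y).1) Z)
      + fieldDeriv Z (formApply (fun y ↦ (a y).2) (fun y ↦ (b y).1)) :=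
  funext fun _ ↦ courantBracket_snd_apply_of_isotropic ha.field ha.form hb.field hb.form hZ
    fun y ↦ hL.isotropic (ha.mem y) (hb.mem y)

omit [T2Space M] in
theorem IsDirac.fieldDeriv_formApply_courantBracket (hL : IsDirac I L)
    {Z V : ∀ x : M, TangentSpace I x}
    (ha : IsSection I (PontryaginModel E) L a) (hb : IsSection I (PontryaginModel E) L b)
    (hZ : SmoothField I Z) :
    fieldDeriv V (formApply (fun y ↦ (courantBracket I a b y).2) Z) =
      fieldDeriv V (fieldDeriv (fun y ↦ (a y).1) (formApply (fun y ↦ (b y).2) Z))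
      - fieldDeriv V (formApply (fun y ↦ (b y).2) (VectorField.mlieBracket I (fun y ↦ (a y).1) Z))
      - fieldDeriv V (fieldDeriv (fun y ↦ (b y).1) (formApply (fun y ↦ (a y).2) Z))
      + fieldDeriv V (formApply (fun y ↦ (a y).2) (VectorField.mlieBracket I (fun y ↦ (b y).1) Z))
      + fieldDeriv V (fieldDeriv Z (formApply (fun y ↦ (a y).2) (fun y ↦ (b y).1))) := by
  have h₁ := contMDiff_fieldDeriv ha.field (hb.form.apply hZ)
  have h₂ := hb.form.apply (ha.field.mlieBracket hZ)
  have h₃ := contMDiff_fieldDeriv hb.field (ha.form.apply hZ)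
  have h₄ := ha.form.apply (hb.field.mlieBracket hZ)
  have h₅ := contMDiff_fieldDeriv hZ (ha.form.apply hb.field)
  rw [hL.formApply_courantBracket ha hb hZ]
  refine (fieldDeriv_add (((h₁.sub h₂).sub h₃).add h₄) h₅).trans ?_
  refine congrArg₂ (· + ·) ((fieldDeriv_add ((h₁.sub h₂).sub h₃) h₄).trans ?_) rfl
  refine congrArg₂ (· + ·) ((fieldDeriv_sub (h₁.sub h₂) h₃).trans ?_) rfl
  exact congrArg₂ (· - ·) (fieldDeriv_sub h₁ h₂) rfl

omit [T2Space M] in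
theorem IsDirac.formApply_courantBracket_courantBracket (hL : IsDirac I L)
    {Z : ∀ x : M, TangentSpace I x}
    (ha : IsSection I (PontryaginModel E) L a) (hb : IsSection I (PontryaginModel E) L b)
    (hc : IsSection I (PontryaginModel E) L c) (hZ : SmoothField I Z) :
    formApply (fun y ↦ (courantBracket I (courantBracket I a b) c y).2) Z =
      fieldDeriv (fun y ↦ (a y).1) (fieldDeriv (fun y ↦ (b y).1) (formApply (fun y ↦ (c y).2) Z))
      - fieldDeriv (fun y ↦ (b y).1) (fieldDeriv (fun y ↦ (a y).1) (formApply (fun y ↦ (c y).2) Z))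
      - formApply (fun y ↦ (c y).2) (VectorField.mlieBracket I
        (VectorField.mlieBracket I (fun y ↦ (a y).1) (fun y ↦ (b y).1)) Z)
      - fieldDeriv (fun y ↦ (c y).1) (fieldDeriv (fun y ↦ (a y).1) (formApply (fun y ↦ (b y).2) Z))
      + fieldDeriv (fun y ↦ (c y).1)
          (formApply (fun y ↦ (b y).2) (VectorField.mlieBracket I (fun y ↦ (a y).1) Z))
      + fieldDeriv (fun y ↦ (c y).1) (fieldDeriv (fun y ↦ (b y).1) (formApply (fun y ↦ (a y).2) Z))
      - fieldDeriv (fun y ↦ (c y).1)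
          (formApply (fun y ↦ (a y).2) (VectorField.mlieBracket I (fun y ↦ (b y).1) Z))
      + fieldDeriv (fun y ↦ (a y).1)
          (formApply (fun y ↦ (b y).2) (VectorField.mlieBracket I (fun y ↦ (c y).1) Z))
      - formApply (fun y ↦ (b y).2) (VectorField.mlieBracket I (fun y ↦ (a y).1)
          (VectorField.mlieBracket I (fun y ↦ (c y).1) Z))
      - fieldDeriv (fun y ↦ (b y).1)
          (formApply (fun y ↦ (a y).2) (VectorField.mlieBracket I (fun y ↦ (c y).1) Z))
      + formApply (fun y ↦ (a y).2) (VectorField.mlieBracket I (fun y ↦ (b y).1)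
          (VectorField.mlieBracket I (fun y ↦ (c y).1) Z))
      - fieldDeriv Z (fieldDeriv (fun y ↦ (c y).1)
          (formApply (fun y ↦ (a y).2) (fun y ↦ (b y).1)))
      + fieldDeriv Z (formApply (fun y ↦ (courantBracket I a b y).2) (fun y ↦ (c y).1)) := by
  have h₁ : (fun y ↦ (courantBracket I a b y).1) =
      VectorField.mlieBracket I (fun y ↦ (a y).1) (fun y ↦ (b y).1) := rfl
  rw [hL.formApply_courantBracket (hL.closed a b ha hb) hc hZ, h₁,
    hL.formApply_courantBracket ha hb (hc.field.mlieBracket hZ),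
    hL.fieldDeriv_formApply_courantBracket ha hb hZ,
    fieldDeriv_mlieBracket (f := formApply (fun y ↦ (c y).2) Z) ha.field hb.field
      (hc.form.apply hZ),
    fieldDeriv_mlieBracket (f := formApply (fun y ↦ (a y).2) (fun y ↦ (b y).1)) hc.field hZ
      (ha.form.apply hb.field)]
  abel

theorem IsDirac.courantBracket_jacobi (hL : IsDirac I L)
    (ha : IsSection I (PontryaginModel E) L a) (hb : IsSection I (PontryaginModel E) L b)
    (hc : IsSection I (PontryaginModel E) L c) :
    courantBracket I (courantBracket I a b) c + courantBracket I (courantBracket I b c) a +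
      courantBracket I (courantBracket I c a) b = 0 := by
  have : IsManifold I (minSmoothness ℝ 3) M := by
    rw [minSmoothness_of_isRCLikeNormedField]; infer_instance
  have h2 : minSmoothness ℝ 2 ≤ ∞ := by
    rw [minSmoothness_of_isRCLikeNormedField]; exact ENat.LEInfty.out
  have jac : ∀ {X Y Z : ∀ x : M, TangentSpace I x} (x : M), SmoothField I X → SmoothField I Y →
      SmoothField I Z → VectorField.mlieBracket I (VectorField.mlieBracket I X Y) Z x =
        VectorField.mlieBracket I X (VectorField.mlieBracket I Y Z) x -
        VectorField.mlieBracket I Y (VectorField.mlieBracket I X Z) x := fun x hX hY hZ ↦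
    eq_sub_of_add_eq (VectorField.leibniz_identity_mlieBracket_apply ((hX x).of_le h2)
      ((hY x).of_le h2) ((hZ x).of_le h2)).symm
  have swap : ∀ (X Y : ∀ x : M, TangentSpace I x) (x : M),
      VectorField.mlieBracket I X Y x = -VectorField.mlieBracket I Y X x := fun X Y x ↦
    VectorField.mlieBracket_swap_apply
  funext x
  refine Prod.ext ?_ (cotangent_ext (I := I) fun Z hZ ↦ ?_)
  · change VectorField.mlieBracket I (VectorField.mlieBracket I (fun y ↦ (a y).1) (fun y ↦ (b y).1))
        (fun y ↦ (c y).1) x +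
      VectorField.mlieBracket I (VectorField.mlieBracket I (fun y ↦ (b y).1) (fun y ↦ (c y).1))
        (fun y ↦ (a y).1) x +
      VectorField.mlieBracket I (VectorField.mlieBracket I (fun y ↦ (c y).1) (fun y ↦ (a y).1))
        (fun y ↦ (b y).1) x = 0
    rw [jac x ha.field hb.field hc.field, swap _ (fun y ↦ (a y).1) x, swap _ (fun y ↦ (b y).1) x,
      VectorField.mlieBracket_swap (V := fun y ↦ (c y).1),
      show -VectorField.mlieBracket I (fun y ↦ (a y).1) (fun y ↦ (c y).1) =
        (-1 : ℝ) • VectorField.mlieBracket I (fun y ↦ (a y).1) (fun y ↦ (c y).1) by simp,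
      VectorField.mlieBracket_const_smul_right
        ((ha.field.mlieBracket hc.field x).mdifferentiableAt (by simp))]
    simp only [neg_smul, one_smul, neg_neg]
    abel
  · have hR : ∀ {a b c : ∀ x, Pontryagin I M x}, IsSection I (PontryaginModel E) L a →
        IsSection I (PontryaginModel E) L b → IsSection I (PontryaginModel E) L c →
        fieldDeriv Z (formApply (fun y ↦ (courantBracket I a b y).2) (fun y ↦ (c y).1)) =
          -fieldDeriv Z (formApply (fun y ↦ (c y).2)
            (VectorField.mlieBracket I (fun y ↦ (a y).1) (fun y ↦ (b y).1))) := by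
      intro a b c ha hb hc
      rw [← fieldDeriv_neg]
      exact congrArg _ (funext fun y ↦ hL.isotropic (hc.mem y) ((hL.closed a b ha hb).mem y))
    have hs : ∀ {a b : ∀ x, Pontryagin I M x} (V : ∀ x : M, TangentSpace I x),
        IsSection I (PontryaginModel E) L a → IsSection I (PontryaginModel E) L b →
        fieldDeriv V (formApply (fun y ↦ (a y).2) (fun y ↦ (b y).1)) =
          -fieldDeriv V (formApply (fun y ↦ (b y).2) (fun y ↦ (a y).1)) := by
      intro a b V ha hb
      rw [← fieldDeriv_neg]
      exact congrArg _ (funext fun y ↦ hL.isotropic (hb.mem y) (ha.mem y))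
    have hE := hL.fieldDeriv_formApply_courantBracket (V := Z) ha hb hc.field
    rw [hs (a := a) (b := c) _ ha hc, fieldDeriv_neg] at hE
    have hj : ∀ {a b : ∀ x, Pontryagin I M x} (γ : ∀ x : M, CotangentSpace I x),
        IsSection I (PontryaginModel E) L a → IsSection I (PontryaginModel E) L b →
        formApply γ (VectorField.mlieBracket I
          (VectorField.mlieBracket I (fun y ↦ (a y).1) (fun y ↦ (b y).1)) Z) =
        formApply γ (VectorField.mlieBracket I (fun y ↦ (a y).1)
          (VectorField.mlieBracket I (fun y ↦ (b y).1) Z)) -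
        formApply γ (VectorField.mlieBracket I (fun y ↦ (b y).1)
          (VectorField.mlieBracket I (fun y ↦ (a y).1) Z)) := fun γ ha hb ↦
      funext fun y ↦ (congrArg (γ y) (jac y ha.field hb.field hZ)).trans (map_sub _ _ _)
    have hca : fieldDeriv Z (formApply (fun y ↦ (b y).2)
        (VectorField.mlieBracket I (fun y ↦ (c y).1) (fun y ↦ (a y).1))) =
        -fieldDeriv Z (formApply (fun y ↦ (b y).2)
          (VectorField.mlieBracket I (fun y ↦ (a y).1) (fun y ↦ (c y).1))) := by
      rw [← fieldDeriv_neg]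
      exact congrArg _ (funext fun y ↦ (congrArg (b y).2 (swap _ _ y)).trans (map_neg _ _))
    rw [hR ha hb hc] at hE
    have hf := congrFun (hL.formApply_courantBracket_courantBracket ha hb hc hZ) x
    have hg := congrFun (hL.formApply_courantBracket_courantBracket hb hc ha hZ) x
    have hh := congrFun (hL.formApply_courantBracket_courantBracket hc ha hb hZ) x
    rw [hR ha hb hc, hj _ ha hb] at hf
    rw [hR hb hc ha, hj _ hb hc] at hg
    rw [hR hc ha hb, hj _ hc ha, hca] at hh
    have hE := congrFun hE x
    simp only [Pi.add_apply, Pi.sub_apply, Pi.neg_apply] at hf hg hh hE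
    change formApply (fun y ↦ (courantBracket I (courantBracket I a b) c y).2) Z x +
      formApply (fun y ↦ (courantBracket I (courantBracket I b c) a y).2) Z x +
      formApply (fun y ↦ (courantBracket I (courantBracket I c a) b y).2) Z x = 0
    rw [hf, hg, hh]
    linear_combination hE

/-- A Dirac structure is a Lie algebroid for the Courant bracket. -/
theorem IsDirac.isLieAlgebroid (hL : IsDirac I L) :
    IsLieAlgebroid I (PontryaginModel E) L (courantBracket I) (pontryaginAnchor I) where
  subbundle := hL.subbundle
  bracket_mem := hL.closed
  add_left a b c ha hb hc := hL.courantBracket_add_left ha hb hc (ha.add hb)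
  smul_left r a b ha hb := by
    have hra : IsSection I (PontryaginModel E) L (fun y ↦ r • a y) :=
      ha.smul (f := fun _ ↦ r) contMDiff_const
    have h := hL.courantBracket_leibniz (f := fun _ ↦ r) contMDiff_const hb ha hra
    funext x
    have h₁ : courantBracket I (r • a) b x = -courantBracket I b (fun y ↦ r • a y) x :=
      eq_neg_of_add_eq_zero_left (congrFun (hL.courantBracket_skew hra hb) x)
    have h₂ : courantBracket I a b x = -courantBracket I b a x :=
      eq_neg_of_add_eq_zero_left (congrFun (hL.courantBracket_skew ha hb) x)
    have h₃ : mvfderiv I (fun _ : M ↦ r) x (b x).1 = 0 :=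
      congrArg (fun l : TangentSpace I x →L[ℝ] ℝ ↦ l (b x).1) (mvfderiv_const r)
    rw [h₁, h x, h₃, zero_smul, add_zero, Pi.smul_apply, h₂, smul_neg]
  skew a b := hL.courantBracket_skew
  jacobi a b c := hL.courantBracket_jacobi
  anchor_smooth a ha := ha.field
  anchor_bracket a b _ _ x := rfl
  leibniz f a b hf ha hb := hL.courantBracket_leibniz hf ha hb (hb.smul hf)

end Algebroid

end DiracAlgebroid

/-! ### Vector fields and functions on `M × ℝ` -/

section Product

variable {E : Type*} [NormedAddCommGroup E] [NormedSpace ℝ E]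
  {H : Type*} [TopologicalSpace H] {I : ModelWithCorners ℝ E H}
  {M : Type*} [TopologicalSpace M] [ChartedSpace H M]

theorem contMDiff_slice (τ : ℝ) : ContMDiff I (I.prod 𝓘(ℝ, ℝ)) ∞ (fun y : M ↦ (y, τ)) :=
  contMDiff_id.prodMk contMDiff_const

theorem contMDiff_timeLine (x : M) :
    ContMDiff 𝓘(ℝ, ℝ) (I.prod 𝓘(ℝ, ℝ)) ∞ (fun τ : ℝ ↦ (x, τ)) :=
  contMDiff_const.prodMk contMDiff_id

theorem mvfderiv_prod_apply {h : M × ℝ → ℝ} {p : M × ℝ}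
    (hh : MDifferentiableAt (I.prod 𝓘(ℝ, ℝ)) 𝓘(ℝ, ℝ) h p)
    (w : TangentSpace (I.prod 𝓘(ℝ, ℝ)) p) :
    mvfderiv (I.prod 𝓘(ℝ, ℝ)) h p w =
      mvfderiv I (fun y ↦ h (y, p.2)) p.1 w.1 + w.2 * deriv (fun τ ↦ h (p.1, τ)) p.2 := by
  have h₁ := mfderiv_prod_eq_add_apply (v := w) hh
  have h₂ : (mfderiv 𝓘(ℝ, ℝ) 𝓘(ℝ, ℝ) (fun τ ↦ h (p.1, τ)) p.2 : ℝ →L[ℝ] ℝ) w.2 =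
      w.2 * deriv (fun τ ↦ h (p.1, τ)) p.2 := by
    rw [mfderiv_eq_fderiv, ← toSpanSingleton_deriv]
    rfl
  exact h₁.trans (congrArg (fun r : ℝ ↦ mvfderiv I (fun y ↦ h (y, p.2)) p.1 w.1 + r) h₂)

variable [IsManifold I ∞ M]

theorem fieldSmoothAt_prod_iff {N : Type*} {E' : Type*} [NormedAddCommGroup E'] [NormedSpace ℝ E']
    {H' : Type*} [TopologicalSpace H'] {J : ModelWithCorners ℝ E' H'} [TopologicalSpace N]
    [ChartedSpace H' N] {b : N → M × ℝ} {W : ∀ q, TangentSpace (I.prod 𝓘(ℝ, ℝ)) (b q)} {p : N}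
    (hb : ContMDiffAt J (I.prod 𝓘(ℝ, ℝ)) ∞ b p) :
    FieldSmoothAt (I.prod 𝓘(ℝ, ℝ)) J b W p ↔
      FieldSmoothAt I J (fun q ↦ (b q).1) (fun q ↦ (W q).1) p ∧
        ContMDiffAt J 𝓘(ℝ, ℝ) ∞ (fun q ↦ (W q).2) p := by
  have h₂ : ContMDiffAt J (𝓘(ℝ, ℝ).prod 𝓘(ℝ, ℝ)) ∞
      (fun q ↦ (TotalSpace.mk' ℝ (b q).2 (W q).2 : TangentBundle 𝓘(ℝ, ℝ) ℝ)) p ↔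
      ContMDiffAt J 𝓘(ℝ, ℝ) ∞ (fun q ↦ (W q).2) p := by
    rw [contMDiffAt_totalSpace]
    have : ContMDiffAt J 𝓘(ℝ, ℝ) ∞ (fun q ↦ (b q).2) p := contMDiffAt_snd.comp p hb
    constructor
    · rintro ⟨-, h⟩
      simpa using h
    · intro h
      exact ⟨this, by simpa using h⟩
  rw [← h₂]
  constructor
  · intro h
    have h' := ((contMDiff_equivTangentBundleProd (n := ∞) (I := I) (M := M) (I' := 𝓘(ℝ, ℝ))
      (M' := ℝ)) _).comp p h
    exact ⟨contMDiffAt_fst.comp p h', contMDiffAt_snd.comp p h'⟩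
  · rintro ⟨h₁, h₂⟩
    exact ((contMDiff_equivTangentBundleProd_symm (n := ∞) (I := I) (M := M) (I' := 𝓘(ℝ, ℝ))
      (M' := ℝ)) _).comp p (h₁.prodMk h₂)

/-- A curve in a fixed tangent space. -/
theorem contDiffAt_of_fieldSmoothAt {x : M} {γ : ℝ → E} {t : ℝ}
    (h : FieldSmoothAt I 𝓘(ℝ, ℝ) (fun _ ↦ x) γ t) : ContDiffAt ℝ ∞ γ t := by
  have h' := (contMDiffAt_totalSpace.1 h).2
  have he : (fun τ ↦ (trivializationAt E (TangentSpace I) x (TotalSpace.mk' E x (γ τ))).2) =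
      γ := by
    funext τ
    exact (tangentBundleCore I M).coordChange_self _ _ (mem_achart_source H x) _
  exact (he ▸ h' : ContMDiffAt 𝓘(ℝ, ℝ) 𝓘(ℝ, E) ∞ γ t).contDiffAt

theorem contDiffAt_of_formSmoothAt [FiniteDimensional ℝ E] [T2Space M] {x : M}
    {γ : ℝ → E →L[ℝ] ℝ} {t : ℝ} (h : FormSmoothAt I 𝓘(ℝ, ℝ) (fun _ ↦ x) γ t) :
    ContDiffAt ℝ ∞ γ t := by
  refine (contMDiffAt_clm_of_apply fun w ↦ ?_).contDiffAt
  obtain ⟨Z, hZ, hw⟩ := exists_smoothField_eq (I := I) x w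
  have h' : FieldSmoothAt I 𝓘(ℝ, ℝ) (fun _ ↦ x) (fun _ ↦ Z x) t :=
    ContMDiffAt.comp (g := fun y ↦ (TotalSpace.mk' E y (Z y) : TangentBundle I M))
      (f := fun _ : ℝ ↦ x) t (hZ x) contMDiffAt_const
  exact hw ▸ h.apply h'

/-- The time derivative of a time-dependent section. -/
noncomputable def timeDeriv {V : M → Type*} [∀ x, AddCommGroup (V x)] [∀ x, Module ℝ (V x)]
    [∀ x, TopologicalSpace (V x)] (s : ∀ q : M × ℝ, V q.1) (p : M × ℝ) : V p.1 :=
  deriv (fun τ ↦ s (p.1, τ)) p.2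

section Fields

variable {X : ∀ q : M × ℝ, TangentSpace I q.1}

theorem SmoothField.slice (hX : ∀ p, FieldSmoothAt I (I.prod 𝓘(ℝ, ℝ)) Prod.fst X p) (t : ℝ) :
    SmoothField I (fun y ↦ X (y, t)) :=
  fun x ↦ (hX (x, t)).comp x (contMDiff_slice t x)

theorem hasDerivAt_field (hX : ∀ p, FieldSmoothAt I (I.prod 𝓘(ℝ, ℝ)) Prod.fst X p) (x : M)
    (t : ℝ) : HasDerivAt (fun τ ↦ (X (x, τ) : E)) (timeDeriv X (x, t) : E) t :=
  ((contDiffAt_of_fieldSmoothAt ((hX (x, t)).comp t (contMDiff_timeLine x t))).differentiableAt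
    (by simp)).hasDerivAt

theorem deriv_clm_field (hX : ∀ p, FieldSmoothAt I (I.prod 𝓘(ℝ, ℝ)) Prod.fst X p) {x : M} {t : ℝ}
    (α : CotangentSpace I x) :
    deriv (fun τ ↦ α (X (x, τ))) t = α (timeDeriv X (x, t)) :=
  ((show E →L[ℝ] ℝ from α).hasFDerivAt.comp_hasDerivAt t (hasDerivAt_field hX x t)).deriv

theorem contMDiff_mvfderiv_apply_field {h : M → ℝ} (hh : ContMDiff I 𝓘(ℝ, ℝ) ∞ h)
    [FiniteDimensional ℝ E] [T2Space M]
    (hX : ∀ p, FieldSmoothAt I (I.prod 𝓘(ℝ, ℝ)) Prod.fst X p) :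
    ContMDiff (I.prod 𝓘(ℝ, ℝ)) 𝓘(ℝ, ℝ) ∞ (fun q : M × ℝ ↦ mvfderiv I h q.1 (X q)) := fun p ↦
  FormSmoothAt.apply ((SmoothForm.mvfderiv hh p.1).comp p contMDiffAt_fst) (hX p)

end Fields

section Bracket

variable {W₁ W₂ : ∀ q : M × ℝ, TangentSpace (I.prod 𝓘(ℝ, ℝ)) q}

theorem SmoothField.prod_fst (hW : SmoothField (I.prod 𝓘(ℝ, ℝ)) W₁) (p : M × ℝ) :
    FieldSmoothAt I (I.prod 𝓘(ℝ, ℝ)) Prod.fst (fun q ↦ (W₁ q).1) p :=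
  ((fieldSmoothAt_prod_iff (b := fun q ↦ q) contMDiffAt_id).1 (hW p)).1

theorem SmoothField.prod_snd (hW : SmoothField (I.prod 𝓘(ℝ, ℝ)) W₁) :
    ContMDiff (I.prod 𝓘(ℝ, ℝ)) 𝓘(ℝ, ℝ) ∞ (fun q ↦ (W₁ q).2) :=
  fun p ↦ ((fieldSmoothAt_prod_iff (b := fun q ↦ q) contMDiffAt_id).1 (hW p)).2

omit [IsManifold I ∞ M] in
theorem mvfderiv_comp_fst {h : M → ℝ} (hh : ContMDiff I 𝓘(ℝ, ℝ) ∞ h) {p : M × ℝ}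
    (w : TangentSpace (I.prod 𝓘(ℝ, ℝ)) p) :
    mvfderiv (I.prod 𝓘(ℝ, ℝ)) (fun q : M × ℝ ↦ h q.1) p w = mvfderiv I h p.1 w.1 := by
  rw [mvfderiv_prod_apply (h := fun q : M × ℝ ↦ h q.1)
    ((hh.comp contMDiff_fst).mdifferentiableAt (by simp))]
  simp

omit [IsManifold I ∞ M] in
theorem mvfderiv_snd {p : M × ℝ} (w : TangentSpace (I.prod 𝓘(ℝ, ℝ)) p) :
    mvfderiv (I.prod 𝓘(ℝ, ℝ)) (fun q : M × ℝ ↦ q.2) p w = w.2 := by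
  rw [mvfderiv_prod_apply (contMDiff_snd.mdifferentiableAt (n := ∞) (by simp))]
  have : mvfderiv I (fun _ : M ↦ p.2) p.1 w.1 = 0 :=
    congrArg (fun l : TangentSpace I p.1 →L[ℝ] ℝ ↦ l w.1) (mvfderiv_const p.2)
  rw [this]
  simp

variable [FiniteDimensional ℝ E] [I.Boundaryless]

theorem mlieBracket_prod_fst [T2Space M] (h₁ : SmoothField (I.prod 𝓘(ℝ, ℝ)) W₁)
    (h₂ : SmoothField (I.prod 𝓘(ℝ, ℝ)) W₂) (p : M × ℝ) :
    ((VectorField.mlieBracket (I.prod 𝓘(ℝ, ℝ)) W₁ W₂ p).1 : TangentSpace I p.1) =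
      VectorField.mlieBracket I (fun y ↦ (W₁ (y, p.2)).1) (fun y ↦ (W₂ (y, p.2)).1) p.1
        + (W₁ p).2 • timeDeriv (V := TangentSpace I) (fun q ↦ (W₂ q).1) p
        - (W₂ p).2 • timeDeriv (V := TangentSpace I) (fun q ↦ (W₁ q).1) p := by
  refine tangent_ext fun h hh ↦ ?_
  have e₁ := mvfderiv_mlieBracket (x := p) (hh.comp contMDiff_fst) h₁ h₂
  have e₂ : ∀ (W : ∀ q : M × ℝ, TangentSpace (I.prod 𝓘(ℝ, ℝ)) q) (q : M × ℝ),
      mvfderiv (I.prod 𝓘(ℝ, ℝ)) (h ∘ Prod.fst) q (W q) = mvfderiv I h q.1 (W q).1 :=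
    fun W q ↦ mvfderiv_comp_fst hh (W q)
  have e₃ : ∀ {W W' : ∀ q : M × ℝ, TangentSpace (I.prod 𝓘(ℝ, ℝ)) q},
      SmoothField (I.prod 𝓘(ℝ, ℝ)) W →
      mvfderiv (I.prod 𝓘(ℝ, ℝ)) (fun q ↦ mvfderiv I h q.1 (W q).1) p (W' p) =
        mvfderiv I (fun y ↦ mvfderiv I h y (W (y, p.2)).1) p.1 (W' p).1 +
          (W' p).2 * mvfderiv I h p.1 (timeDeriv (V := TangentSpace I) (fun q ↦ (W q).1) p) := by
    intro W W' hW
    rw [mvfderiv_prod_apply ((contMDiff_mvfderiv_apply_field hh hW.prod_fst).mdifferentiableAt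
      (by simp))]
    exact congrArg (fun r : ℝ ↦ _ + _ * r) 
      (deriv_clm_field (x := p.1) (t := p.2) hW.prod_fst (mvfderiv I h p.1))
  have e₄ := mvfderiv_mlieBracket (x := p.1) hh (SmoothField.slice h₁.prod_fst p.2)
    (SmoothField.slice h₂.prod_fst p.2)
  simp only [e₂] at e₁
  rw [e₃ h₁, e₃ h₂] at e₁
  rw [map_sub, map_add, map_smul, map_smul, e₄, smul_eq_mul, smul_eq_mul]
  refine e₁.trans ?_
  ring

theorem mlieBracket_prod_snd (h₁ : SmoothField (I.prod 𝓘(ℝ, ℝ)) W₁)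
    (h₂ : SmoothField (I.prod 𝓘(ℝ, ℝ)) W₂) (p : M × ℝ) :
    ((VectorField.mlieBracket (I.prod 𝓘(ℝ, ℝ)) W₁ W₂ p).2 : ℝ) =
      mvfderiv I (fun y ↦ (W₂ (y, p.2)).2) p.1 (W₁ p).1
        + (W₁ p).2 * deriv (fun τ ↦ (W₂ (p.1, τ)).2) p.2
        - (mvfderiv I (fun y ↦ (W₁ (y, p.2)).2) p.1 (W₂ p).1
          + (W₂ p).2 * deriv (fun τ ↦ (W₁ (p.1, τ)).2) p.2) := by
  have e₁ := mvfderiv_mlieBracket (x := p) (contMDiff_snd (n := ∞)) h₁ h₂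
  have e₂ : ∀ (W : ∀ q : M × ℝ, TangentSpace (I.prod 𝓘(ℝ, ℝ)) q) (q : M × ℝ),
      mvfderiv (I.prod 𝓘(ℝ, ℝ)) Prod.snd q (W q) = (W q).2 := fun W q ↦ mvfderiv_snd (W q)
  simp only [e₂] at e₁
  rw [mvfderiv_prod_apply (h₁.prod_snd.mdifferentiableAt (by simp)),
    mvfderiv_prod_apply (h₂.prod_snd.mdifferentiableAt (by simp))] at e₁
  exact e₁

end Bracket

end Product

/-! ### Time-dependent sections of `ℰ¹(M)` -/

section TimeSections

variable {E : Type*} [NormedAddCommGroup E] [NormedSpace ℝ E]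
  {H : Type*} [TopologicalSpace H] {I : ModelWithCorners ℝ E H}
  {M : Type*} [TopologicalSpace M] [ChartedSpace H M]

theorem psi_snd_apply (p : M × ℝ) (a : EOne I M p.1) (w : TangentSpace (I.prod 𝓘(ℝ, ℝ)) p) :
    (psi I p a).2 w = Real.exp p.2 * (a.2.1 w.1 + a.2.2 * w.2) := rfl

variable [IsManifold I ∞ M]

/-- Smoothness of a time-dependent section of `ℰ¹(M)`, through its components. -/
structure TimeSmoothAt (s : ∀ q : M × ℝ, EOne I M q.1) (p : M × ℝ) : Prop where
  field : FieldSmoothAt I (I.prod 𝓘(ℝ, ℝ)) Prod.fst (fun q ↦ (s q).1.1) p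
  cocycle : ContMDiffAt (I.prod 𝓘(ℝ, ℝ)) 𝓘(ℝ, ℝ) ∞ (fun q ↦ (s q).1.2) p
  form : FormSmoothAt I (I.prod 𝓘(ℝ, ℝ)) Prod.fst (fun q ↦ (s q).2.1) p
  coform : ContMDiffAt (I.prod 𝓘(ℝ, ℝ)) 𝓘(ℝ, ℝ) ∞ (fun q ↦ (s q).2.2) p

theorem contMDiffAt_eone_iff {N : Type*} {E' : Type*} [NormedAddCommGroup E'] [NormedSpace ℝ E']
    {H' : Type*} [TopologicalSpace H'] {J : ModelWithCorners ℝ E' H'} [TopologicalSpace N]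
    [ChartedSpace H' N] {b : N → M} {s : ∀ q, EOne I M (b q)} {p : N}
    (hb : ContMDiffAt J I ∞ b p) :
    ContMDiffAt J (I.prod 𝓘(ℝ, EOneModel E)) ∞
      (fun q ↦ (TotalSpace.mk' (EOneModel E) (b q) (s q) : TotalSpace (EOneModel E) (EOne I M))) p ↔
    FieldSmoothAt I J b (fun q ↦ (s q).1.1) p ∧
      ContMDiffAt J 𝓘(ℝ, ℝ) ∞ (fun q ↦ (s q).1.2) p ∧
      FormSmoothAt I J b (fun q ↦ (s q).2.1) p ∧
      ContMDiffAt J 𝓘(ℝ, ℝ) ∞ (fun q ↦ (s q).2.2) p := by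
  have h₁ := contMDiffAt_prodBundle_iff (I := I) (J := J) (F₁ := E × ℝ) (F₂ := (E →L[ℝ] ℝ) × ℝ)
    (V₁ := (TangentSpace I : M → Type _) ×ᵇ (Bundle.Trivial M ℝ))
    (V₂ := (CotangentSpace I : M → Type _) ×ᵇ (Bundle.Trivial M ℝ))
    (v₁ := fun q ↦ (s q).1) (v₂ := fun q ↦ (s q).2) (p := p)
  have h₂ := contMDiffAt_prodBundle_iff (I := I) (J := J) (F₁ := E) (F₂ := ℝ)
    (V₁ := (TangentSpace I : M → Type _)) (V₂ := Bundle.Trivial M ℝ)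
    (v₁ := fun q ↦ (s q).1.1) (v₂ := fun q ↦ (s q).1.2) (p := p)
  have h₃ := contMDiffAt_prodBundle_iff (I := I) (J := J) (F₁ := E →L[ℝ] ℝ) (F₂ := ℝ)
    (V₁ := (CotangentSpace I : M → Type _)) (V₂ := Bundle.Trivial M ℝ)
    (v₁ := fun q ↦ (s q).2.1) (v₂ := fun q ↦ (s q).2.2) (p := p)
  have h₄ := contMDiffAt_trivialBundle_iff (I := I) (J := J) (b := b) (g := fun q ↦ (s q).1.2)
    (p := p)
  have h₅ := contMDiffAt_trivialBundle_iff (I := I) (J := J) (b := b) (g := fun q ↦ (s q).2.2)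
    (p := p)
  refine h₁.trans ((and_congr (h₂.trans (and_congr_right fun _ ↦ ?_))
    (h₃.trans (and_congr_right fun _ ↦ ?_))).trans and_assoc)
  · exact h₄.trans (and_iff_right hb)
  · exact h₅.trans (and_iff_right hb)

theorem contMDiffAt_bar_iff {s : ∀ q, (⇑(timeProj I M) *ᵖ (EOne I M)) q} {p : M × ℝ} :
    ContMDiffAt (I.prod 𝓘(ℝ, ℝ)) ((I.prod 𝓘(ℝ, ℝ)).prod 𝓘(ℝ, EOneModel E)) ∞
      (fun q ↦ (TotalSpace.mk' (EOneModel E) q (s q) :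
        TotalSpace (EOneModel E) (⇑(timeProj I M) *ᵖ (EOne I M)))) p ↔
    TimeSmoothAt (I := I) s p := by
  have h := (contMDiffAt_pullback_iff (I := I) (timeProj I M) (V₁ := EOne I M) (s := s)
    (p := p)).trans (contMDiffAt_eone_iff contMDiffAt_fst)
  exact h.trans ⟨fun ⟨h₁, h₂, h₃, h₄⟩ ↦ ⟨h₁, h₂, h₃, h₄⟩, fun ⟨h₁, h₂, h₃, h₄⟩ ↦ ⟨h₁, h₂, h₃, h₄⟩⟩

omit [IsManifold I ∞ M] in
theorem contMDiff_exp_snd :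
    ContMDiff (I.prod 𝓘(ℝ, ℝ)) 𝓘(ℝ, ℝ) ∞ (fun q : M × ℝ ↦ Real.exp q.2) :=
  Real.contDiff_exp.contMDiff.comp contMDiff_snd

theorem smoothField_comp_fst {Z : ∀ x : M, TangentSpace I x} (hZ : SmoothField I Z) {c : ℝ} :
    SmoothField (I.prod 𝓘(ℝ, ℝ)) (M := M × ℝ) (fun q ↦ (Z q.1, c)) := fun p ↦
  (fieldSmoothAt_prod_iff (b := fun q ↦ q) contMDiffAt_id).2
    ⟨ContMDiffAt.comp (g := fun y ↦ (TotalSpace.mk' E y (Z y) : TangentBundle I M)) p (hZ p.1)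
      contMDiffAt_fst, contMDiffAt_const⟩

theorem smoothField_zero : SmoothField I (fun x : M ↦ (0 : TangentSpace I x)) :=
  contMDiff_zeroSection ℝ (TangentSpace I : M → Type _)

theorem contMDiffAt_psi_iff [FiniteDimensional ℝ E] [T2Space M]
    {s : ∀ q : M × ℝ, EOne I M q.1} {p : M × ℝ} :
    ContMDiffAt (I.prod 𝓘(ℝ, ℝ)) ((I.prod 𝓘(ℝ, ℝ)).prod 𝓘(ℝ, PontryaginModel (E × ℝ))) ∞
      (fun q ↦ TotalSpace.mk' (PontryaginModel (E × ℝ)) q (psi I q (s q))) p ↔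
    TimeSmoothAt s p := by
  have hexp := fun p ↦ contMDiff_exp_snd (I := I) (M := M) p
  have hf : FieldSmoothAt (I.prod 𝓘(ℝ, ℝ)) (I.prod 𝓘(ℝ, ℝ)) (fun q ↦ q)
      (fun q : M × ℝ ↦ (psi I q (s q)).1) p ↔
      FieldSmoothAt I (I.prod 𝓘(ℝ, ℝ)) Prod.fst (fun q ↦ (s q).1.1) p ∧
        ContMDiffAt (I.prod 𝓘(ℝ, ℝ)) 𝓘(ℝ, ℝ) ∞ (fun q ↦ (s q).1.2) p :=
    fieldSmoothAt_prod_iff (b := fun q ↦ q) contMDiffAt_id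
  rw [contMDiffAt_pontryagin_iff, hf]
  constructor
  · rintro ⟨⟨h₁, h₂⟩, h₃⟩
    have key : ∀ {Z : ∀ x : M, TangentSpace I x} (c : ℝ), SmoothField I Z →
        ContMDiffAt (I.prod 𝓘(ℝ, ℝ)) 𝓘(ℝ, ℝ) ∞
          (fun q : M × ℝ ↦ (s q).2.1 (Z q.1) + (s q).2.2 * c) p := by
      intro Z c hZ
      have h := ((hexp p).inv₀ (Real.exp_pos _).ne').mul
        (h₃.apply (smoothField_comp_fst hZ (c := c) p))
      refine h.congr_of_eventuallyEq (Filter.Eventually.of_forall fun q ↦ ?_)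
      exact (inv_mul_cancel_left₀ (Real.exp_pos q.2).ne' _).symm
    refine ⟨h₁, h₂, formSmoothAt_of_apply contMDiffAt_fst fun Z hZ ↦ ?_, ?_⟩
    · simpa using key 0 hZ
    · simpa using key 1 smoothField_zero
  · rintro ⟨h₁, h₂, h₃, h₄⟩
    refine ⟨⟨h₁, h₂⟩, formSmoothAt_of_apply contMDiffAt_id fun Z hZ ↦ ?_⟩
    obtain ⟨hZ₁, hZ₂⟩ := (fieldSmoothAt_prod_iff (b := fun q ↦ q) contMDiffAt_id).1 (hZ p)
    exact (hexp p).mul ((h₃.apply hZ₁).add (h₄.mul hZ₂))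

end TimeSections

/-! ### Derivatives of time-dependent sections and of their images under `psi` -/

section TimeBracket

variable {E : Type*} [NormedAddCommGroup E] [NormedSpace ℝ E] [FiniteDimensional ℝ E]
  {H : Type*} [TopologicalSpace H] {I : ModelWithCorners ℝ E H}
  {M : Type*} [TopologicalSpace M] [ChartedSpace H M] [IsManifold I ∞ M] [T2Space M]
  {s t : ∀ q : M × ℝ, EOne I M q.1}

theorem hasDerivAt_form {α : ∀ q : M × ℝ, CotangentSpace I q.1}
    (hα : ∀ p, FormSmoothAt I (I.prod 𝓘(ℝ, ℝ)) Prod.fst α p) (p : M × ℝ) :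
    HasDerivAt (fun τ ↦ (α (p.1, τ) : E →L[ℝ] ℝ))
      (timeDeriv (V := CotangentSpace I) α p : E →L[ℝ] ℝ) p.2 :=
  have h : FormSmoothAt I 𝓘(ℝ, ℝ) (fun _ ↦ p.1) (fun τ ↦ α (p.1, τ)) p.2 :=
    (hα (p.1, p.2)).comp p.2 (contMDiff_timeLine p.1 p.2)
  ((contDiffAt_of_formSmoothAt h).differentiableAt (by simp)).hasDerivAt

omit [FiniteDimensional ℝ E] [IsManifold I ∞ M] [T2Space M] in
theorem hasDerivAt_timeLine {f : M × ℝ → ℝ} (hf : ContMDiff (I.prod 𝓘(ℝ, ℝ)) 𝓘(ℝ, ℝ) ∞ f)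
    (p : M × ℝ) :
    HasDerivAt (fun τ ↦ f (p.1, τ)) (deriv (fun τ ↦ f (p.1, τ)) p.2) p.2 :=
  ((hf.comp (contMDiff_timeLine p.1)).contDiff.differentiable (by simp) p.2).hasDerivAt

theorem hasDerivAt_eone (hs : ∀ p, TimeSmoothAt s p) (p : M × ℝ) :
    HasDerivAt (fun τ ↦ (s (p.1, τ) : EOneModel E))
      (((timeDeriv (V := TangentSpace I) (fun q ↦ (s q).1.1) p,
          deriv (fun τ ↦ (s (p.1, τ)).1.2) p.2),
        (timeDeriv (V := CotangentSpace I) (fun q ↦ (s q).2.1) p,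
          deriv (fun τ ↦ (s (p.1, τ)).2.2) p.2)) : EOneModel E) p.2 :=
  have h₁ := (hasDerivAt_field (fun q ↦ (hs q).field) p.1 p.2).prodMk
    (hasDerivAt_timeLine (fun q ↦ (hs q).cocycle) p)
  have h₂ := HasDerivAt.prodMk (F := E →L[ℝ] ℝ) (G := ℝ)
    (hasDerivAt_form (fun q ↦ (hs q).form) p) (hasDerivAt_timeLine (fun q ↦ (hs q).coform) p)
  HasDerivAt.prodMk (F := E × ℝ) (G := (E →L[ℝ] ℝ) × ℝ) h₁ h₂

theorem timeDeriv_eone (hs : ∀ p, TimeSmoothAt s p) (p : M × ℝ) :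
    timeDeriv (V := EOne I M) s p =
      ((timeDeriv (V := TangentSpace I) (fun q ↦ (s q).1.1) p,
          deriv (fun τ ↦ (s (p.1, τ)).1.2) p.2),
        (timeDeriv (V := CotangentSpace I) (fun q ↦ (s q).2.1) p,
          deriv (fun τ ↦ (s (p.1, τ)).2.2) p.2)) :=
  (hasDerivAt_eone hs p).deriv

omit [IsManifold I ∞ M] [T2Space M] in
/-- A curve in a subspace has its velocity in the subspace. -/
theorem timeDeriv_mem {L : ∀ x, Submodule ℝ (EOne I M x)} (hL : ∀ q, s q ∈ L q.1) (p : M × ℝ) :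
    timeDeriv (V := EOne I M) s p ∈ L p.1 := by
  let S : Submodule ℝ (EOneModel E) := L p.1
  let γ : ℝ → EOneModel E := fun τ ↦ s (p.1, τ)
  have h := range_deriv_subset_closure_span_image (𝕜 := ℝ) γ dense_univ (mem_range_self p.2)
  have hS : Submodule.span ℝ (γ '' univ) ≤ S := by
    rw [Submodule.span_le]
    rintro _ ⟨τ, -, rfl⟩
    exact hL (p.1, τ)
  exact closure_minimal hS S.closed_of_finiteDimensional h

theorem deriv_form_apply_field {α : ∀ q : M × ℝ, CotangentSpace I q.1}
    {X : ∀ q : M × ℝ, TangentSpace I q.1}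
    (hα : ∀ p, FormSmoothAt I (I.prod 𝓘(ℝ, ℝ)) Prod.fst α p)
    (hX : ∀ p, FieldSmoothAt I (I.prod 𝓘(ℝ, ℝ)) Prod.fst X p) (p : M × ℝ) :
    deriv (fun τ ↦ α (p.1, τ) (X (p.1, τ))) p.2 =
      timeDeriv (V := CotangentSpace I) α p (X p) +
        α p (timeDeriv (V := TangentSpace I) X p) :=
  ((hasDerivAt_form hα p).clm_apply (hasDerivAt_field hX p.1 p.2)).deriv

omit [FiniteDimensional ℝ E] [T2Space M] in
theorem SmoothForm.slice {α : ∀ q : M × ℝ, CotangentSpace I q.1}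
    (hα : ∀ p, FormSmoothAt I (I.prod 𝓘(ℝ, ℝ)) Prod.fst α p) (t : ℝ) :
    SmoothForm I (fun y ↦ α (y, t)) :=
  fun x ↦ (hα (x, t)).comp x (contMDiff_slice t x)

theorem mvfderiv_psi_snd_apply {W : ∀ q : M × ℝ, TangentSpace (I.prod 𝓘(ℝ, ℝ)) q}
    (hs : ∀ p, TimeSmoothAt s p) (hW : SmoothField (I.prod 𝓘(ℝ, ℝ)) W) (p : M × ℝ)
    (w : TangentSpace (I.prod 𝓘(ℝ, ℝ)) p) :
    mvfderiv (I.prod 𝓘(ℝ, ℝ)) (fun q ↦ (psi I q (s q)).2 (W q)) p w =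
      Real.exp p.2 * (mvfderiv I (fun y ↦ (s (y, p.2)).2.1 (W (y, p.2)).1) p.1 w.1
        + ((s p).2.2 * mvfderiv I (fun y ↦ (W (y, p.2)).2) p.1 w.1
          + (W p).2 * mvfderiv I (fun y ↦ (s (y, p.2)).2.2) p.1 w.1)
        + w.2 * ((s p).2.1 (W p).1 + (s p).2.2 * (W p).2
          + (timeDeriv (V := CotangentSpace I) (fun q ↦ (s q).2.1) p (W p).1
            + (s p).2.1 (timeDeriv (V := TangentSpace I) (fun q ↦ (W q).1) p))
          + (deriv (fun τ ↦ (s (p.1, τ)).2.2) p.2 * (W p).2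
            + (s p).2.2 * deriv (fun τ ↦ (W (p.1, τ)).2) p.2))) := by
  have hα := fun p ↦ (hs p).form
  have hg : ContMDiff (I.prod 𝓘(ℝ, ℝ)) 𝓘(ℝ, ℝ) ∞ fun q ↦ (s q).2.2 := fun p ↦ (hs p).coform
  have hf := hW.prod_snd
  have hX := hW.prod_fst
  have h₁ : ContMDiff (I.prod 𝓘(ℝ, ℝ)) 𝓘(ℝ, ℝ) ∞ fun q ↦ (s q).2.1 (W q).1 :=
    fun p ↦ (hα p).apply (hX p)
  have h₂ := h₁.add (hg.mul hf)
  have e₂ : deriv (fun τ ↦ Real.exp τ * ((s (p.1, τ)).2.1 (W (p.1, τ)).1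
      + (s (p.1, τ)).2.2 * (W (p.1, τ)).2)) p.2 = Real.exp p.2 * ((s p).2.1 (W p).1
      + (s p).2.2 * (W p).2) + Real.exp p.2 *
        ((timeDeriv (V := CotangentSpace I) (fun q ↦ (s q).2.1) p (W p).1
            + (s p).2.1 (timeDeriv (V := TangentSpace I) (fun q ↦ (W q).1) p))
          + (deriv (fun τ ↦ (s (p.1, τ)).2.2) p.2 * (W p).2
            + (s p).2.2 * deriv (fun τ ↦ (W (p.1, τ)).2) p.2)) := by
    rw [← deriv_form_apply_field hα hX p]
    exact ((Real.hasDerivAt_exp p.2).mul ((hasDerivAt_timeLine h₁ p).add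
      ((hasDerivAt_timeLine hg p).mul (hasDerivAt_timeLine hf p)))).deriv
  have e₃ : mvfderiv I (fun y ↦ Real.exp p.2 * ((s (y, p.2)).2.1 (W (y, p.2)).1
      + (s (y, p.2)).2.2 * (W (y, p.2)).2)) p.1 w.1 =
      Real.exp p.2 * (mvfderiv I (fun y ↦ (s (y, p.2)).2.1 (W (y, p.2)).1) p.1 w.1
        + ((s p).2.2 * mvfderiv I (fun y ↦ (W (y, p.2)).2) p.1 w.1
          + (W p).2 * mvfderiv I (fun y ↦ (s (y, p.2)).2.2) p.1 w.1)) := by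
    have d₁ := (h₁.comp (contMDiff_slice p.2)).mdifferentiableAt (x := p.1) (by simp)
    have d₂ := (hg.comp (contMDiff_slice p.2)).mdifferentiableAt (x := p.1) (by simp)
    have d₃ := (hf.comp (contMDiff_slice p.2)).mdifferentiableAt (x := p.1) (by simp)
    have k₁ := mvfderiv_fun_mul_apply (mdifferentiableAt_const (c := Real.exp p.2))
      (d₁.add (d₂.mul d₃)) w.1
    have k₂ := mvfderiv_fun_add_apply d₁ (d₂.mul d₃) w.1
    have k₃ := mvfderiv_fun_mul_apply d₂ d₃ w.1
    have k₄ : mvfderiv I (fun _ : M ↦ Real.exp p.2) p.1 w.1 = 0 :=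
      congrArg (fun l : TangentSpace I p.1 →L[ℝ] ℝ ↦ l w.1) (mvfderiv_const _)
    refine k₁.trans ?_
    rw [k₄, mul_zero, add_zero]
    exact congrArg (Real.exp p.2 * ·) (k₂.trans (congrArg (_ + ·) k₃))
  have e₁ := mvfderiv_prod_apply (p := p) (w := w)
    (h := fun q ↦ Real.exp q.2 * ((s q).2.1 (W q).1 + (s q).2.2 * (W q).2))
    ((contMDiff_exp_snd.mul h₂).mdifferentiableAt (by simp))
  refine (e₁.trans (congrArg₂ (fun a b : ℝ ↦ a + w.2 * b) e₃ e₂)).trans ?_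
  ring

theorem psi_snd_mlieBracket [I.Boundaryless]
    {W W' : ∀ q : M × ℝ, TangentSpace (I.prod 𝓘(ℝ, ℝ)) q}
    (hW : SmoothField (I.prod 𝓘(ℝ, ℝ)) W) (hW' : SmoothField (I.prod 𝓘(ℝ, ℝ)) W') (p : M × ℝ)
    (a : EOne I M p.1) :
    (psi I p a).2 (VectorField.mlieBracket (I.prod 𝓘(ℝ, ℝ)) W W' p) =
      Real.exp p.2 *
        (a.2.1 (VectorField.mlieBracket I (fun y ↦ (W (y, p.2)).1) (fun y ↦ (W' (y, p.2)).1) p.1)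
        + (W p).2 * a.2.1 (timeDeriv (V := TangentSpace I) (fun q ↦ (W' q).1) p)
        - (W' p).2 * a.2.1 (timeDeriv (V := TangentSpace I) (fun q ↦ (W q).1) p)
        + a.2.2 * (mvfderiv I (fun y ↦ (W' (y, p.2)).2) p.1 (W p).1
        + (W p).2 * deriv (fun τ ↦ (W' (p.1, τ)).2) p.2
        - (mvfderiv I (fun y ↦ (W (y, p.2)).2) p.1 (W' p).1
          + (W' p).2 * deriv (fun τ ↦ (W (p.1, τ)).2) p.2))) := by
  rw [psi_snd_apply, mlieBracket_prod_fst hW hW', mlieBracket_prod_snd hW hW', map_sub, map_add,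
    map_smul, map_smul]
  rfl

end TimeBracket

/-! ### Compatibility of `psi` with the brackets -/

section PsiBracket

variable {E : Type*} [NormedAddCommGroup E] [NormedSpace ℝ E] [FiniteDimensional ℝ E]
  {H : Type*} [TopologicalSpace H] {I : ModelWithCorners ℝ E H} [I.Boundaryless]
  {M : Type*} [TopologicalSpace M] [ChartedSpace H M] [IsManifold I ∞ M] [T2Space M]
  {s t : ∀ q : M × ℝ, EOne I M q.1}

omit [FiniteDimensional ℝ E] [I.Boundaryless] [IsManifold I ∞ M] [T2Space M] in
theorem barBracket_eq (p : M × ℝ) :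
    barBracket I (eoneBracket I) (eoneCocycle I) s t p =
      (eoneBracket I (fun x ↦ s (x, p.2)) (fun x ↦ t (x, p.2)) p.1
        + (s p).1.2 • timeDeriv (V := EOne I M) t p - (t p).1.2 • timeDeriv (V := EOne I M) s p :
        EOne I M p.1) := rfl

omit [T2Space M] in
/-- The form part of `eoneBracket` on orthogonal sections. -/
theorem eoneBracket_form_apply {a b : ∀ x : M, EOne I M x}
    (ha₁ : SmoothField I (fun y ↦ (a y).1.1)) (ha₂ : ContMDiff I 𝓘(ℝ, ℝ) ∞ (fun y ↦ (a y).1.2))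
    (ha₃ : SmoothForm I (fun y ↦ (a y).2.1)) (ha₄ : ContMDiff I 𝓘(ℝ, ℝ) ∞ (fun y ↦ (a y).2.2))
    (hb₁ : SmoothField I (fun y ↦ (b y).1.1)) (hb₂ : ContMDiff I 𝓘(ℝ, ℝ) ∞ (fun y ↦ (b y).1.2))
    (hb₃ : SmoothForm I (fun y ↦ (b y).2.1)) (hb₄ : ContMDiff I 𝓘(ℝ, ℝ) ∞ (fun y ↦ (b y).2.2))
    (hab : ∀ y, eonePairing I y (a y) (b y) = 0)
    {Z : ∀ x : M, TangentSpace I x} (hZ : SmoothField I Z) (x : M) :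
    (eoneBracket I a b x).2.1 (Z x) =
      mvfderiv I (fun y ↦ (b y).2.1 (Z y)) x (a x).1.1
        - (b x).2.1 (VectorField.mlieBracket I (fun y ↦ (a y).1.1) Z x)
      - (mvfderiv I (fun y ↦ (a y).2.1 (Z y)) x (b x).1.1
        - (a x).2.1 (VectorField.mlieBracket I (fun y ↦ (b y).1.1) Z x))
      + mvfderiv I (fun y ↦ (a y).2.1 (b y).1.1) x (Z x)
      + (a x).1.2 * (b x).2.1 (Z x) - (b x).1.2 * (a x).2.1 (Z x)
      + (b x).2.2 * mvfderiv I (fun y ↦ (a y).1.2) x (Z x)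
      + (b x).1.2 * mvfderiv I (fun y ↦ (a y).2.2) x (Z x) := by
  have hp : (fun y ↦ (a y).2.1 (b y).1.1 - (b y).2.1 (a y).1.1) =
      fun y ↦ ((a y).2.1 (b y).1.1 + (a y).2.1 (b y).1.1) +
        ((b y).1.2 * (a y).2.2 + (a y).1.2 * (b y).2.2) := by
    funext y
    have h : (1 / 2 : ℝ) * ((a y).2.1 (b y).1.1 + (b y).1.2 * (a y).2.2 + (b y).2.1 (a y).1.1
      + (a y).1.2 * (b y).2.2) = 0 := hab y
    linarith
  have d₁ := (ha₃.apply hb₁).mdifferentiableAt (x := x) (by simp)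
  have da₂ := ha₂.mdifferentiableAt (x := x) (by simp)
  have da₄ := ha₄.mdifferentiableAt (x := x) (by simp)
  have db₂ := hb₂.mdifferentiableAt (x := x) (by simp)
  have db₄ := hb₄.mdifferentiableAt (x := x) (by simp)
  have k : mvfderiv I (fun y ↦ (a y).2.1 (b y).1.1 - (b y).2.1 (a y).1.1) x (Z x) =
      mvfderiv I (fun y ↦ (a y).2.1 (b y).1.1) x (Z x)
      + mvfderiv I (fun y ↦ (a y).2.1 (b y).1.1) x (Z x)
      + ((b x).1.2 * mvfderiv I (fun y ↦ (a y).2.2) x (Z x)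
        + (a x).2.2 * mvfderiv I (fun y ↦ (b y).1.2) x (Z x)
        + ((a x).1.2 * mvfderiv I (fun y ↦ (b y).2.2) x (Z x)
        + (b x).2.2 * mvfderiv I (fun y ↦ (a y).1.2) x (Z x))) := by
    rw [hp]
    have k₁ := mvfderiv_fun_add_apply (d₁.add d₁) ((db₂.mul da₄).add (da₂.mul db₄)) (Z x)
    have k₂ := mvfderiv_fun_add_apply d₁ d₁ (Z x)
    have k₃ := mvfderiv_fun_add_apply (db₂.mul da₄) (da₂.mul db₄) (Z x)
    have k₄ := mvfderiv_fun_mul_apply db₂ da₄ (Z x)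
    have k₅ := mvfderiv_fun_mul_apply da₂ db₄ (Z x)
    exact k₁.trans (congrArg₂ (· + ·) k₂ (k₃.trans (congrArg₂ (· + ·) k₄ k₅)))
  have e : (eoneBracket I a b x).2.1 (Z x) =
      lieDerivForm I (fun y ↦ (a y).1.1) (fun y ↦ (b y).2.1) x (Z x)
      - lieDerivForm I (fun y ↦ (b y).1.1) (fun y ↦ (a y).2.1) x (Z x)
      + (1 / 2 : ℝ) * mvfderiv I (fun y ↦ (a y).2.1 (b y).1.1 - (b y).2.1 (a y).1.1) x (Z x)
      + (a x).1.2 * (b x).2.1 (Z x) - (b x).1.2 * (a x).2.1 (Z x)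
      + (1 / 2 : ℝ) * ((b x).2.2 * mvfderiv I (fun y ↦ (a y).1.2) x (Z x)
        - (a x).2.2 * mvfderiv I (fun y ↦ (b y).1.2) x (Z x)
        - (a x).1.2 * mvfderiv I (fun y ↦ (b y).2.2) x (Z x)
        + (b x).1.2 * mvfderiv I (fun y ↦ (a y).2.2) x (Z x)) := rfl
  rw [e, k, lieDerivForm_apply (ha₁ x) (hZ x) (hb₃ x), lieDerivForm_apply (hb₁ x) (hZ x) (ha₃ x)]
  ring

omit [FiniteDimensional ℝ E] [I.Boundaryless] [IsManifold I ∞ M] [T2Space M] in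
theorem pontryaginPairing_psi (p : M × ℝ) (a b : EOne I M p.1) :
    pontryaginPairing (I.prod 𝓘(ℝ, ℝ)) p (psi I p a) (psi I p b) =
      Real.exp p.2 * eonePairing I p.1 a b := by
  change (1 / 2 : ℝ) * (Real.exp p.2 * (a.2.1 b.1.1 + a.2.2 * b.1.2)
    + Real.exp p.2 * (b.2.1 a.1.1 + b.2.2 * a.1.2)) =
    Real.exp p.2 * ((1 / 2 : ℝ) * (a.2.1 b.1.1 + b.1.2 * a.2.2 + b.2.1 a.1.1 + a.1.2 * b.2.2))
  ring

omit [FiniteDimensional ℝ E] [I.Boundaryless] [IsManifold I ∞ M] [T2Space M] in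
theorem timeDeriv_comp_fst (Z : ∀ x : M, TangentSpace I x) (p : M × ℝ) :
    timeDeriv (V := TangentSpace I) (fun q : M × ℝ ↦ Z q.1) p = 0 :=
  deriv_const p.2 (show E from Z p.1)

omit [I.Boundaryless] in
theorem mvfderiv_psi_snd_apply_comp_fst (hs : ∀ p, TimeSmoothAt s p)
    {Z : ∀ x : M, TangentSpace I x} (hZ : SmoothField I Z) (c : ℝ) (p : M × ℝ)
    (w : TangentSpace (I.prod 𝓘(ℝ, ℝ)) p) :
    mvfderiv (I.prod 𝓘(ℝ, ℝ)) (fun q ↦ (psi I q (s q)).2 (Z q.1, c)) p w =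
      Real.exp p.2 * (mvfderiv I (fun y ↦ (s (y, p.2)).2.1 (Z y)) p.1 w.1
        + c * mvfderiv I (fun y ↦ (s (y, p.2)).2.2) p.1 w.1
        + w.2 * ((s p).2.1 (Z p.1) + (s p).2.2 * c
          + timeDeriv (V := CotangentSpace I) (fun q ↦ (s q).2.1) p (Z p.1)
          + deriv (fun τ ↦ (s (p.1, τ)).2.2) p.2 * c)) := by
  have h := mvfderiv_psi_snd_apply hs (smoothField_comp_fst hZ (c := c)) p w
  have k : mvfderiv I (fun _ : M ↦ c) p.1 w.1 = 0 :=
    congrArg (fun l : TangentSpace I p.1 →L[ℝ] ℝ ↦ l w.1) (mvfderiv_const c)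
  dsimp only at h
  rw [timeDeriv_comp_fst, map_zero, k, deriv_const] at h
  refine h.trans ?_
  ring

theorem psi_snd_mlieBracket_comp_fst {W : ∀ q : M × ℝ, TangentSpace (I.prod 𝓘(ℝ, ℝ)) q}
    (hW : SmoothField (I.prod 𝓘(ℝ, ℝ)) W) {Z : ∀ x : M, TangentSpace I x} (hZ : SmoothField I Z)
    (c : ℝ) (p : M × ℝ) (a : EOne I M p.1) :
    (psi I p a).2 (VectorField.mlieBracket (I.prod 𝓘(ℝ, ℝ)) W (fun q : M × ℝ ↦ (Z q.1, c)) p) =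
      Real.exp p.2 * (a.2.1 (VectorField.mlieBracket I (fun y ↦ (W (y, p.2)).1) Z p.1)
        - c * a.2.1 (timeDeriv (V := TangentSpace I) (fun q ↦ (W q).1) p)
        - a.2.2 * (mvfderiv I (fun y ↦ (W (y, p.2)).2) p.1 (Z p.1)
          + c * deriv (fun τ ↦ (W (p.1, τ)).2) p.2)) := by
  have h := psi_snd_mlieBracket hW (smoothField_comp_fst hZ (c := c)) p a
  have k : mvfderiv I (fun _ : M ↦ c) p.1 (W p).1 = 0 :=
    congrArg (fun l : TangentSpace I p.1 →L[ℝ] ℝ ↦ l (W p).1) (mvfderiv_const c)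
  dsimp only at h
  rw [timeDeriv_comp_fst, map_zero, k, deriv_const] at h
  refine h.trans ?_
  ring

theorem psi_barBracket (hs : ∀ p, TimeSmoothAt s p) (ht : ∀ p, TimeSmoothAt t p)
    (hst : ∀ p, eonePairing I p.1 (s p) (t p) = 0) (p : M × ℝ)
    (hst' : eonePairing I p.1 (timeDeriv (V := EOne I M) s p) (t p) = 0) :
    psi I p (barBracket I (eoneBracket I) (eoneCocycle I) s t p) =
      courantBracket (I.prod 𝓘(ℝ, ℝ)) (fun q ↦ psi I q (s q)) (fun q ↦ psi I q (t q)) p := by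
  have hps := fun p ↦ contMDiffAt_pontryagin_iff.1 (contMDiffAt_psi_iff.2 (hs p))
  have hpt := fun p ↦ contMDiffAt_pontryagin_iff.1 (contMDiffAt_psi_iff.2 (ht p))
  have hW₁ : SmoothField (I.prod 𝓘(ℝ, ℝ)) fun q ↦ (psi I q (s q)).1 := fun p ↦ (hps p).1
  have hA₁ : SmoothForm (I.prod 𝓘(ℝ, ℝ)) fun q ↦ (psi I q (s q)).2 := fun p ↦ (hps p).2
  have hW₂ : SmoothField (I.prod 𝓘(ℝ, ℝ)) fun q ↦ (psi I q (t q)).1 := fun p ↦ (hpt p).1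
  have hA₂ : SmoothForm (I.prod 𝓘(ℝ, ℝ)) fun q ↦ (psi I q (t q)).2 := fun p ↦ (hpt p).2
  have hiso : ∀ q, (psi I q (t q)).2 (psi I q (s q)).1 = -(psi I q (s q)).2 (psi I q (t q)).1 := by
    intro q
    have h : (1 / 2 : ℝ) * ((psi I q (s q)).2 (psi I q (t q)).1
        + (psi I q (t q)).2 (psi I q (s q)).1) = Real.exp q.2 * eonePairing I q.1 (s q) (t q) :=
      pontryaginPairing_psi q (s q) (t q)
    rw [hst q] at h
    linarith
  have hbar := barBracket_eq (s := s) (t := t) p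
  rw [timeDeriv_eone hs, timeDeriv_eone ht] at hbar
  rw [timeDeriv_eone hs] at hst'
  refine Prod.ext ?_ ?_
  · refine Prod.ext ?_ ?_
    · refine Eq.trans ?_ (mlieBracket_prod_fst hW₁ hW₂ p).symm
      rw [hbar]
      rfl
    · refine Eq.trans ?_ (mlieBracket_prod_snd hW₁ hW₂ p).symm
      rw [hbar]
      change mvfderiv I (fun y ↦ (t (y, p.2)).1.2) p.1 (s p).1.1
        - mvfderiv I (fun y ↦ (s (y, p.2)).1.2) p.1 (t p).1.1
        + (s p).1.2 * deriv (fun τ ↦ (t (p.1, τ)).1.2) p.2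
        - (t p).1.2 * deriv (fun τ ↦ (s (p.1, τ)).1.2) p.2 =
        mvfderiv I (fun y ↦ (t (y, p.2)).1.2) p.1 (s p).1.1
        + (s p).1.2 * deriv (fun τ ↦ (t (p.1, τ)).1.2) p.2
        - (mvfderiv I (fun y ↦ (s (y, p.2)).1.2) p.1 (t p).1.1
        + (t p).1.2 * deriv (fun τ ↦ (s (p.1, τ)).1.2) p.2)
      ring
  · refine ContinuousLinearMap.ext fun w ↦ ?_
    obtain ⟨Z, hZ, hw⟩ := exists_smoothField_eq (I := I) p.1 w.1
    obtain ⟨c, hc⟩ : ∃ c : ℝ, c = w.2 := ⟨_, rfl⟩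
    obtain rfl : w = ((Z p.1, c) : E × ℝ) := Prod.ext hw.symm hc.symm
    have h := courantBracket_snd_apply_of_isotropic (x := p) hW₁ hA₁ hW₂ hA₂
      (smoothField_comp_fst hZ (c := c)) hiso
    rw [mvfderiv_psi_snd_apply_comp_fst ht hZ, mvfderiv_psi_snd_apply_comp_fst hs hZ,
      psi_snd_mlieBracket_comp_fst hW₁ hZ, psi_snd_mlieBracket_comp_fst hW₂ hZ] at h
    have hr : (courantBracket (I.prod 𝓘(ℝ, ℝ)) (fun q ↦ psi I q (s q)) (fun q ↦ psi I q (t q))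
        p).2 ((Z p.1, c) : E × ℝ) =
        Real.exp p.2 * (mvfderiv I (fun y ↦ (t (y, p.2)).2.1 (Z y)) p.1 (s p).1.1
          + c * mvfderiv I (fun y ↦ (t (y, p.2)).2.2) p.1 (s p).1.1
          + (s p).1.2 * ((t p).2.1 (Z p.1) + (t p).2.2 * c
            + timeDeriv (V := CotangentSpace I) (fun q ↦ (t q).2.1) p (Z p.1)
            + deriv (fun τ ↦ (t (p.1, τ)).2.2) p.2 * c))
        - Real.exp p.2 * ((t p).2.1 (VectorField.mlieBracket I (fun y ↦ (s (y, p.2)).1.1) Z p.1)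
          - c * (t p).2.1 (timeDeriv (V := TangentSpace I) (fun q ↦ (s q).1.1) p)
          - (t p).2.2 * (mvfderiv I (fun y ↦ (s (y, p.2)).1.2) p.1 (Z p.1)
            + c * deriv (fun τ ↦ (s (p.1, τ)).1.2) p.2))
        - Real.exp p.2 * (mvfderiv I (fun y ↦ (s (y, p.2)).2.1 (Z y)) p.1 (t p).1.1
          + c * mvfderiv I (fun y ↦ (s (y, p.2)).2.2) p.1 (t p).1.1
          + (t p).1.2 * ((s p).2.1 (Z p.1) + (s p).2.2 * c
            + timeDeriv (V := CotangentSpace I) (fun q ↦ (s q).2.1) p (Z p.1)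
            + deriv (fun τ ↦ (s (p.1, τ)).2.2) p.2 * c))
        + Real.exp p.2 * ((s p).2.1 (VectorField.mlieBracket I (fun y ↦ (t (y, p.2)).1.1) Z p.1)
          - c * (s p).2.1 (timeDeriv (V := TangentSpace I) (fun q ↦ (t q).1.1) p)
          - (s p).2.2 * (mvfderiv I (fun y ↦ (t (y, p.2)).1.2) p.1 (Z p.1)
            + c * deriv (fun τ ↦ (t (p.1, τ)).1.2) p.2))
        + Real.exp p.2 * (mvfderiv I (fun y ↦ (s (y, p.2)).2.1 (t (y, p.2)).1.1) p.1 (Z p.1)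
          + ((s p).2.2 * mvfderiv I (fun y ↦ (t (y, p.2)).1.2) p.1 (Z p.1)
            + (t p).1.2 * mvfderiv I (fun y ↦ (s (y, p.2)).2.2) p.1 (Z p.1))
          + c * ((s p).2.1 (t p).1.1 + (s p).2.2 * (t p).1.2
            + (timeDeriv (V := CotangentSpace I) (fun q ↦ (s q).2.1) p (t p).1.1
            + (s p).2.1 (timeDeriv (V := TangentSpace I) (fun q ↦ (t q).1.1) p))
            + (deriv (fun τ ↦ (s (p.1, τ)).2.2) p.2 * (t p).1.2
            + (s p).2.2 * deriv (fun τ ↦ (t (p.1, τ)).1.2) p.2))) :=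
      h.trans (congrArg (_ + ·) (mvfderiv_psi_snd_apply hs hW₂ p ((Z p.1, c) : E × ℝ)))
    have hl : (psi I p (barBracket I (eoneBracket I) (eoneCocycle I) s t p)).2
        ((Z p.1, c) : E × ℝ) =
        Real.exp p.2 * ((eoneBracket I (fun x ↦ s (x, p.2)) (fun x ↦ t (x, p.2)) p.1).2.1 (Z p.1)
          + (s p).1.2 * timeDeriv (V := CotangentSpace I) (fun q ↦ (t q).2.1) p (Z p.1)
          - (t p).1.2 * timeDeriv (V := CotangentSpace I) (fun q ↦ (s q).2.1) p (Z p.1)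
          + (mvfderiv I (fun y ↦ (t (y, p.2)).2.2) p.1 (s p).1.1
            - mvfderiv I (fun y ↦ (s (y, p.2)).2.2) p.1 (t p).1.1
            + (1 / 2 : ℝ) * ((s p).2.1 (t p).1.1 - (t p).2.1 (s p).1.1
              - (t p).1.2 * (s p).2.2 + (s p).1.2 * (t p).2.2)
            + (s p).1.2 * deriv (fun τ ↦ (t (p.1, τ)).2.2) p.2
            - (t p).1.2 * deriv (fun τ ↦ (s (p.1, τ)).2.2) p.2) * c) := by
      rw [hbar]
      rfl
    have hm := eoneBracket_form_apply (I := I) (a := fun x ↦ s (x, p.2)) (b := fun x ↦ t (x, p.2))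
      (SmoothField.slice (fun q ↦ (hs q).field) p.2)
      (fun x ↦ (hs _).cocycle.comp x (contMDiff_slice p.2 x))
      (SmoothForm.slice (fun q ↦ (hs q).form) p.2)
      (fun x ↦ (hs _).coform.comp x (contMDiff_slice p.2 x))
      (SmoothField.slice (fun q ↦ (ht q).field) p.2)
      (fun x ↦ (ht _).cocycle.comp x (contMDiff_slice p.2 x))
      (SmoothForm.slice (fun q ↦ (ht q).form) p.2)
      (fun x ↦ (ht _).coform.comp x (contMDiff_slice p.2 x))
      (fun y ↦ hst (y, p.2)) hZ p.1
    have i₁ : (1 / 2 : ℝ) * ((s p).2.1 (t p).1.1 + (t p).1.2 * (s p).2.2 + (t p).2.1 (s p).1.1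
      + (s p).1.2 * (t p).2.2) = 0 := hst p
    have i₂ : (1 / 2 : ℝ) * (timeDeriv (V := CotangentSpace I) (fun q ↦ (s q).2.1) p (t p).1.1
      + (t p).1.2 * deriv (fun τ ↦ (s (p.1, τ)).2.2) p.2
      + (t p).2.1 (timeDeriv (V := TangentSpace I) (fun q ↦ (s q).1.1) p)
      + deriv (fun τ ↦ (s (p.1, τ)).1.2) p.2 * (t p).2.2) = 0 := hst'
    rw [hl, hr, hm]
    dsimp only [Prod.mk.eta]
    linear_combination (-Real.exp p.2 * c) * i₁ - 2 * Real.exp p.2 * c * i₂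

end PsiBracket

/-! ### The Dirac structure on `M × ℝ` -/

section Suspension

variable {E : Type*} [NormedAddCommGroup E] [NormedSpace ℝ E]
  {H : Type*} [TopologicalSpace H] {I : ModelWithCorners ℝ E H}
  {M : Type*} [TopologicalSpace M] [ChartedSpace H M]

theorem psi_injective (p : M × ℝ) : Function.Injective (psi I p) := by
  let f : EOne I M p.1 →ₗ[ℝ] Pontryagin (I.prod 𝓘(ℝ, ℝ)) (M × ℝ) p := psi I p
  refine (injective_iff_map_eq_zero f).2 fun a ha ↦ ?_
  have h₁ : (psi I p a).1 = 0 := congrArg Prod.fst ha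
  have h₂ : ∀ w : E × ℝ, a.2.1 w.1
      + a.2.2 * w.2 = 0 := fun w ↦ by
    have h : Real.exp p.2 * (a.2.1 w.1
        + a.2.2 * w.2) = 0 :=
      congrArg (fun b : Pontryagin (I.prod 𝓘(ℝ, ℝ)) (M × ℝ) p ↦ b.2 w) ha
    exact (mul_eq_zero.1 h).resolve_left (Real.exp_pos _).ne'
  refine Prod.ext h₁ (Prod.ext (ContinuousLinearMap.ext fun v ↦ ?_) ?_)
  · have h := h₂ (v, 0)
    rw [mul_zero, add_zero] at h
    exact h
  · have h := h₂ (0, 1)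
    rw [mul_one] at h
    exact ((zero_add _).symm.trans (congrArg (· + _) (map_zero a.2.1).symm)).trans h

theorem psi_surjective (p : M × ℝ) : Function.Surjective (psi I p) := by
  rintro ⟨w, A⟩
  let A' : E × ℝ →L[ℝ] ℝ := A
  refine ⟨((((w : E × ℝ).1, (w : E × ℝ).2),
    ((Real.exp p.2)⁻¹ • A'.comp (ContinuousLinearMap.inl ℝ E ℝ), (Real.exp p.2)⁻¹ * A' (0, 1))) :
      EOneModel E), Prod.ext rfl (ContinuousLinearMap.ext fun v ↦ ?_)⟩
  have h : A' ((v : E × ℝ).1, (v : E × ℝ).2) =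
      A' ((v : E × ℝ).1, 0) + A' (0, 1) * (v : E × ℝ).2 := by
    rw [mul_comm, ← smul_eq_mul, ← map_smul, ← map_add]
    simp
  have h' : Real.exp p.2 * ((Real.exp p.2)⁻¹ * A' ((v : E × ℝ).1, 0)
      + (Real.exp p.2)⁻¹ * A' (0, 1) * (v : E × ℝ).2) = A' ((v : E × ℝ).1, (v : E × ℝ).2) := by
    rw [h]
    field_simp
  exact h'

variable {L : ∀ x, Submodule ℝ (EOne I M x)}

theorem isMaxIsotropic_tildeBundle {p : M × ℝ} (hL : IsMaxIsotropic (eonePairing I p.1) (L p.1)) :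
    IsMaxIsotropic (pontryaginPairing (I.prod 𝓘(ℝ, ℝ)) p) (tildeBundle I L p) := by
  refine ⟨?_, fun T hT hle ↦ ?_⟩
  · rintro _ ⟨a, ha, rfl⟩ _ ⟨b, hb, rfl⟩
    exact (pontryaginPairing_psi p a b).trans (by rw [hL.prop a ha b hb, mul_zero])
  · have h : (T.comap (psi I p) : Submodule ℝ (EOne I M p.1)) ≤ L p.1 := by
      refine hL.le_of_ge (fun a ha b hb ↦ ?_) fun a ha ↦ hle ⟨a, ha, rfl⟩
      have h := (pontryaginPairing_psi p a b).symm.trans (hT _ ha _ hb)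
      exact (mul_eq_zero.1 h).resolve_left (Real.exp_pos _).ne'
    intro v hv
    obtain ⟨a, rfl⟩ := psi_surjective p v
    exact ⟨a, h hv, rfl⟩

variable [IsManifold I ∞ M]

theorem TimeSmoothAt.of_comp_fst {s : ∀ x, EOne I M x} {q : M × ℝ}
    (hs : ContMDiffAt I (I.prod 𝓘(ℝ, EOneModel E)) ∞
      (fun x ↦ TotalSpace.mk' (EOneModel E) x (s x)) q.1) :
    TimeSmoothAt (fun q : M × ℝ ↦ s q.1) q :=
  have h := (contMDiffAt_eone_iff (b := Prod.fst) (s := fun q : M × ℝ ↦ s q.1)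
    contMDiffAt_fst).1 (ContMDiffAt.comp
      (g := fun x ↦ (TotalSpace.mk' (EOneModel E) x (s x) : TotalSpace (EOneModel E) (EOne I M)))
      q hs contMDiffAt_fst)
  ⟨h.1, h.2.1, h.2.2.1, h.2.2.2⟩

theorem isSubbundle_barBundle (hL : IsSubbundle I (EOneModel E) L) :
    IsSubbundle (I.prod 𝓘(ℝ, ℝ)) (EOneModel E) (barBundle I L) := by
  intro p
  obtain ⟨U, hU, hp, k, s, hs, h⟩ := hL p.1
  exact ⟨Prod.fst ⁻¹' U, hU.preimage continuous_fst, hp, k, fun i q ↦ s i q.1,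
    fun i q hq ↦ (contMDiffAt_bar_iff.2 (TimeSmoothAt.of_comp_fst
      ((hs i).contMDiffAt (hU.mem_nhds hq)))).contMDiffWithinAt, fun q hq ↦ h q.1 hq⟩

variable [FiniteDimensional ℝ E] [T2Space M]

theorem isSubbundle_tildeBundle (hL : IsSubbundle I (EOneModel E) L) :
    IsSubbundle (I.prod 𝓘(ℝ, ℝ)) (PontryaginModel (E × ℝ)) (tildeBundle I L) := by
  intro p
  obtain ⟨U, hU, hp, k, s, hs, h⟩ := hL p.1
  refine ⟨Prod.fst ⁻¹' U, hU.preimage continuous_fst, hp, k, fun i q ↦ psi I q (s i q.1),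
    fun i q hq ↦ (contMDiffAt_psi_iff.2 (TimeSmoothAt.of_comp_fst
      ((hs i).contMDiffAt (hU.mem_nhds hq)))).contMDiffWithinAt, fun q hq ↦ ⟨?_, ?_⟩⟩
  · exact (h q.1 hq).1.map' (psi I q) (LinearMap.ker_eq_bot.2 (psi_injective q))
  · have h₁ : range (fun i ↦ psi I q (s i q.1)) = psi I q '' range fun i ↦ s i q.1 :=
      range_comp (psi I q) fun i ↦ s i q.1
    rw [h₁, ← Submodule.map_span]
    exact congrArg (Submodule.map (psi I q)) (h q.1 hq).2

variable {s t : ∀ p, (⇑(timeProj I M) *ᵖ (EOne I M)) p}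

omit [FiniteDimensional ℝ E] [T2Space M] in
theorem IsSection.timeSmoothAt
    (hs : IsSection (I.prod 𝓘(ℝ, ℝ)) (EOneModel E) (barBundle I L) s) (p : M × ℝ) :
    TimeSmoothAt (I := I) s p :=
  contMDiffAt_bar_iff.1 (hs.smooth p)

theorem IsSection.psi (hs : IsSection (I.prod 𝓘(ℝ, ℝ)) (EOneModel E) (barBundle I L) s) :
    IsSection (I.prod 𝓘(ℝ, ℝ)) (PontryaginModel (E × ℝ)) (tildeBundle I L)
      (fun q ↦ psi I q (s q)) :=
  ⟨fun p ↦ contMDiffAt_psi_iff.2 (hs.timeSmoothAt p), fun p ↦ ⟨s p, hs.mem p, rfl⟩⟩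

theorem IsSection.exists_eq_psi {a : ∀ p, Pontryagin (I.prod 𝓘(ℝ, ℝ)) (M × ℝ) p}
    (ha : IsSection (I.prod 𝓘(ℝ, ℝ)) (PontryaginModel (E × ℝ)) (tildeBundle I L) a) :
    ∃ s, IsSection (I.prod 𝓘(ℝ, ℝ)) (EOneModel E) (barBundle I L) s ∧
      a = fun q ↦ _root_.psi I q (s q) := by
  choose s hs hsa using ha.mem
  obtain rfl : (fun q ↦ _root_.psi I q (s q)) = a := funext hsa
  exact ⟨s, ⟨fun p ↦ contMDiffAt_bar_iff.2 (contMDiffAt_psi_iff.1 (ha.smooth p)), hs⟩, rfl⟩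

theorem IsSection.of_psi (hs : IsSection (I.prod 𝓘(ℝ, ℝ)) (PontryaginModel (E × ℝ))
    (tildeBundle I L) (fun q ↦ _root_.psi I q (s q))) :
    IsSection (I.prod 𝓘(ℝ, ℝ)) (EOneModel E) (barBundle I L) s := by
  refine ⟨fun p ↦ contMDiffAt_bar_iff.2 (contMDiffAt_psi_iff.1 (hs.smooth p)), fun p ↦ ?_⟩
  obtain ⟨a, ha, h⟩ := hs.mem p
  rwa [← psi_injective p h]

omit [FiniteDimensional ℝ E] [T2Space M] in
theorem IsSection.slice (hs : IsSection (I.prod 𝓘(ℝ, ℝ)) (EOneModel E) (barBundle I L) s)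
    (τ : ℝ) : IsSection I (EOneModel E) L (fun x ↦ s (x, τ)) := by
  refine ⟨fun x ↦ (contMDiffAt_eone_iff (b := fun x ↦ x) contMDiffAt_id).2 ?_,
    fun x ↦ hs.mem (x, τ)⟩
  have h := hs.timeSmoothAt (x, τ)
  exact ⟨h.field.comp x (contMDiff_slice τ x), h.cocycle.comp x (contMDiff_slice τ x),
    h.form.comp x (contMDiff_slice τ x), h.coform.comp x (contMDiff_slice τ x)⟩

omit [T2Space M] in
theorem IsEOneDirac.barBracket_mem (hL : IsEOneDirac I L)
    (hs : IsSection (I.prod 𝓘(ℝ, ℝ)) (EOneModel E) (barBundle I L) s)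
    (ht : IsSection (I.prod 𝓘(ℝ, ℝ)) (EOneModel E) (barBundle I L) t) (p : M × ℝ) :
    barBracket I (eoneBracket I) (eoneCocycle I) s t p ∈ barBundle I L p := by
  have h : (eoneBracket I (fun x ↦ s (x, p.2)) (fun x ↦ t (x, p.2)) p.1
      + (show EOne I M p.1 from s p).1.2 • timeDeriv (V := EOne I M) t p
      - (show EOne I M p.1 from t p).1.2 • timeDeriv (V := EOne I M) s p : EOne I M p.1) ∈ L p.1 :=
    (L p.1).sub_mem ((L p.1).add_mem ((hL.closed _ _ (hs.slice p.2) (ht.slice p.2)).mem p.1)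
      ((L p.1).smul_mem _ (timeDeriv_mem ht.mem p))) ((L p.1).smul_mem _ (timeDeriv_mem hs.mem p))
  exact h

variable [I.Boundaryless]

theorem IsEOneDirac.psi_barBracket (hL : IsEOneDirac I L)
    (hs : IsSection (I.prod 𝓘(ℝ, ℝ)) (EOneModel E) (barBundle I L) s)
    (ht : IsSection (I.prod 𝓘(ℝ, ℝ)) (EOneModel E) (barBundle I L) t) (p : M × ℝ) :
    psi I p (barBracket I (eoneBracket I) (eoneCocycle I) s t p) =
      courantBracket (I.prod 𝓘(ℝ, ℝ)) (fun q ↦ psi I q (s q)) (fun q ↦ psi I q (t q)) p :=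
  _root_.psi_barBracket hs.timeSmoothAt ht.timeSmoothAt
    (fun p ↦ (hL.maxIsotropic p.1).prop _ (hs.mem p) _ (ht.mem p)) p
    ((hL.maxIsotropic p.1).prop _ (timeDeriv_mem hs.mem p) _ (ht.mem p))

/-- The Dirac structure on `M × ℝ` associated with an `ℰ¹(M)`-Dirac structure. -/
theorem IsEOneDirac.isDirac_tildeBundle (hL : IsEOneDirac I L) :
    IsDirac (I.prod 𝓘(ℝ, ℝ)) (tildeBundle I L) where
  subbundle := isSubbundle_tildeBundle hL.subbundle
  maxIsotropic p := isMaxIsotropic_tildeBundle (hL.maxIsotropic p.1)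
  closed a b ha hb := by
    refine ⟨contMDiff_courantBracket ha.field ha.form hb.field hb.form, fun p ↦ ?_⟩
    obtain ⟨s, hs, rfl⟩ := ha.exists_eq_psi
    obtain ⟨t, ht, rfl⟩ := hb.exists_eq_psi
    exact ⟨_, hL.barBracket_mem hs ht p, hL.psi_barBracket hs ht p⟩

theorem IsEOneDirac.isSection_barBracket (hL : IsEOneDirac I L)
    (hs : IsSection (I.prod 𝓘(ℝ, ℝ)) (EOneModel E) (barBundle I L) s)
    (ht : IsSection (I.prod 𝓘(ℝ, ℝ)) (EOneModel E) (barBundle I L) t) :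
    IsSection (I.prod 𝓘(ℝ, ℝ)) (EOneModel E) (barBundle I L)
      (barBracket I (eoneBracket I) (eoneCocycle I) s t) := by
  refine ⟨fun p ↦ contMDiffAt_bar_iff.2 (contMDiffAt_psi_iff.1 ?_), hL.barBracket_mem hs ht⟩
  have h := (hL.isDirac_tildeBundle.closed _ _ hs.psi ht.psi).smooth p
  rwa [← funext (hL.psi_barBracket hs ht)] at h

/-- The Lie algebroid `L × ℝ` over `M × ℝ`. -/
theorem IsEOneDirac.isLieAlgebroid_barBundle (hL : IsEOneDirac I L) :
    IsLieAlgebroid (I.prod 𝓘(ℝ, ℝ)) (EOneModel E) (barBundle I L)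
      (barBracket I (eoneBracket I) (eoneCocycle I))
      (barAnchor I (eoneAnchor I) (eoneCocycle I)) := by
  have hA := hL.isDirac_tildeBundle.isLieAlgebroid
  have hmem := fun s t hs ht ↦ hL.isSection_barBracket (s := s) (t := t) hs ht
  have hpsi := fun {s t} hs ht ↦ funext (hL.psi_barBracket (s := s) (t := t) hs ht)
  have hinj : ∀ {s t : ∀ p, (⇑(timeProj I M) *ᵖ (EOne I M)) p},
      (fun q ↦ psi I q (s q)) = (fun q ↦ psi I q (t q)) → s = t :=
    fun h ↦ funext fun q ↦ psi_injective q (congrFun h q)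
  have hadd : ∀ s t : ∀ p, (⇑(timeProj I M) *ᵖ (EOne I M)) p,
      (fun q ↦ psi I q ((s + t) q)) = (fun q ↦ psi I q (s q)) + fun q ↦ psi I q (t q) :=
    fun _ _ ↦ funext fun q ↦ map_add (psi I q) _ _
  have hsmul : ∀ (c : ℝ) (s : ∀ p, (⇑(timeProj I M) *ᵖ (EOne I M)) p),
      (fun q ↦ psi I q ((c • s) q)) = c • fun q ↦ psi I q (s q) :=
    fun _ _ ↦ funext fun q ↦ map_smul (psi I q) _ _
  have hzero : (fun q ↦ psi I q ((0 : ∀ p, (⇑(timeProj I M) *ᵖ (EOne I M)) p) q)) = 0 :=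
    funext fun q ↦ map_zero (psi I q)
  refine ⟨isSubbundle_barBundle hL.subbundle, hmem, ?_, ?_, ?_, ?_, ?_, ?_, ?_⟩
  · intro s s' t hs hs' ht
    have hss : IsSection (I.prod 𝓘(ℝ, ℝ)) (EOneModel E) (barBundle I L) (s + s') :=
      .of_psi (hadd s s' ▸ hs.psi.add hs'.psi)
    apply hinj
    rw [hpsi hss ht, hadd, hA.add_left _ _ _ hs.psi hs'.psi ht.psi, hadd, hpsi hs ht, hpsi hs' ht]
  · intro c s t hs ht
    have hcs : IsSection (I.prod 𝓘(ℝ, ℝ)) (EOneModel E) (barBundle I L) (c • s) :=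
      .of_psi (hsmul c s ▸ hs.psi.smul (f := fun _ ↦ c) contMDiff_const)
    apply hinj
    rw [hpsi hcs ht, hsmul, hA.smul_left _ _ _ hs.psi ht.psi, hsmul, hpsi hs ht]
  · intro s t hs ht
    apply hinj
    rw [hadd, hpsi hs ht, hpsi ht hs, hzero, hA.skew _ _ hs.psi ht.psi]
  · intro s t u hs ht hu
    apply hinj
    rw [hadd, hadd, hpsi (hmem _ _ hs ht) hu, hpsi (hmem _ _ ht hu) hs, hpsi (hmem _ _ hu hs) ht,
      hpsi hs ht, hpsi ht hu, hpsi hu hs, hzero, hA.jacobi _ _ _ hs.psi ht.psi hu.psi]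
  · exact fun s hs ↦ hA.anchor_smooth _ hs.psi
  · intro s t hs ht p
    exact (congrArg (pontryaginAnchor (I.prod 𝓘(ℝ, ℝ)) p) (hL.psi_barBracket hs ht p)).trans
      (hA.anchor_bracket _ _ hs.psi ht.psi p)
  · intro f s t hf hs ht p
    have h : (fun q ↦ psi I q (f q • t q)) = fun q ↦ f q • psi I q (t q) :=
      funext fun q ↦ map_smul (psi I q) _ _
    have hft : IsSection (I.prod 𝓘(ℝ, ℝ)) (EOneModel E) (barBundle I L) (fun q ↦ f q • t q) :=
      .of_psi (h ▸ ht.psi.smul hf)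
    apply psi_injective p
    rw [hL.psi_barBracket hs hft, h, hA.leibniz f _ _ hf hs.psi ht.psi p, map_add, map_smul,
      map_smul, hL.psi_barBracket hs ht]
    rfl

end Suspension

theorem lemma5p2 {E : Type*} [NormedAddCommGroup E] [NormedSpace ℝ E] [FiniteDimensional ℝ E]
    {H : Type*} [TopologicalSpace H] (I : ModelWithCorners ℝ E H) [I.Boundaryless]
    {M : Type*} [TopologicalSpace M] [ChartedSpace H M] [IsManifold I ∞ M]
    [T2Space M] [SecondCountableTopology M] [ConnectedSpace M]
    (L : ∀ x, Submodule ℝ (EOne I M x)) (hL : IsEOneDirac I L) :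
    IsDirac (I.prod 𝓘(ℝ, ℝ)) (tildeBundle I L) ∧
    IsLieAlgebroidIso (I.prod 𝓘(ℝ, ℝ)) (EOneModel E) (PontryaginModel (E × ℝ))
      (barBundle I L) (barBracket I (eoneBracket I) (eoneCocycle I))
        (barAnchor I (eoneAnchor I) (eoneCocycle I))
      (tildeBundle I L) (courantBracket (I.prod 𝓘(ℝ, ℝ))) (pontryaginAnchor (I.prod 𝓘(ℝ, ℝ)))
      (psi I) ∧
    (∀ p : M × ℝ,
      algebroidFoliation (I.prod 𝓘(ℝ, ℝ)) (tildeBundle I L)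
          (pontryaginAnchor (I.prod 𝓘(ℝ, ℝ))) p =
        algebroidFoliation (I.prod 𝓘(ℝ, ℝ)) (barBundle I L)
          (barAnchor I (eoneAnchor I) (eoneCocycle I)) p) ∧
    ∀ p : M × ℝ,
      leaf (I.prod 𝓘(ℝ, ℝ)) (algebroidFoliation (I.prod 𝓘(ℝ, ℝ)) (tildeBundle I L)
          (pontryaginAnchor (I.prod 𝓘(ℝ, ℝ)))) p =
        leaf (I.prod 𝓘(ℝ, ℝ)) (algebroidFoliation (I.prod 𝓘(ℝ, ℝ)) (barBundle I L)
          (barAnchor I (eoneAnchor I) (eoneCocycle I))) p := by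
  have hfol : ∀ p : M × ℝ, algebroidFoliation (I.prod 𝓘(ℝ, ℝ)) (tildeBundle I L)
      (pontryaginAnchor (I.prod 𝓘(ℝ, ℝ))) p = algebroidFoliation (I.prod 𝓘(ℝ, ℝ)) (barBundle I L)
        (barAnchor I (eoneAnchor I) (eoneCocycle I)) p := fun p ↦
    (Submodule.map_comp (psi I p) (pontryaginAnchor (I.prod 𝓘(ℝ, ℝ)) p) (barBundle I L p)).symm
  refine ⟨hL.isDirac_tildeBundle, ⟨hL.isLieAlgebroid_barBundle,
    hL.isDirac_tildeBundle.isLieAlgebroid, ⟨fun p ↦ ?_, fun s _ p ↦ ?_⟩, fun _ _ _ ↦ rfl,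
    fun s t hs ht ↦ hL.psi_barBracket hs ht⟩, hfol, fun p ↦ ?_⟩
  · exact (psi_injective p).injOn.bijOn_image
  · exact contMDiffAt_bar_iff.trans contMDiffAt_psi_iff.symm
  · rw [funext hfol]
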